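/- Let $k$ be an arbitrary field and $R=k[[x,y]]$. Let $\tau$ be a term ordering on $k[x,y]$ with $x>_\tau y$, and let $\overline\tau$ be the induced local ordering: $m>_{\overline\tau}m'$ if and only if $\deg m<\deg m'$, or $\deg m=\deg m'$ and $m>_\tau m'$. For an ideal $J\subset R$ let $\operatorname{Lt}_{\overline\tau}(J)$ be the ideal generated by the $\overline\tau$-leading terms of the elements of $J$, and let $J^*$ be the ideal generated by the initial forms (nonzero homogeneous components of lowest degree) of the elements of $J$. Let $E\subset R$ be a zero-dimensional monomial ideal, not necessarily lex-segment, written as $E=(x^t,\dots,x^{t-i}y^{m_i},\dots,y^{m_t})$ with $0=m_0<m_1\le\dots\le m_t$, where $m_i$ is the least exponent with $x^{t-i}y^{m_i}\in E$. Put $d_j=m_j-m_{j-1}$ for $1\le j\le t$ and $u_{i,j}=m_j-m_{i-1}+i-j$ for $1\le i\le t+1$, $1\le j\le t$. Then the homogeneous sub-cell $$V_{\hom}(E)=\{J\subset R:\ \operatorname{Lt}_{\overline\tau}(J)=E,\ J=J^*\}$$ is an affine space over $k$ of dimension $$D=\#\{(i,j):\ 1\le j\le t,\ 1\le i\le t+1,\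 i>j,\ 0\le u_{i,j}<d_j\}.$$ Here $V_{\hom}(E)$ is regarded as a reduced subvariety of the Hilbert scheme, in the chart of the ideals $J$ modulo which the monomials outside $E$ form a basis; the coordinates of $J$ are the coefficients $a_{\mu,\nu}$ in $\mu\equiv\sum_{\nu\notin E}a_{\mu,\nu}\,\nu \pmod J$, where $\mu$ runs over all monomials and $\nu$ over the monomials outside $E$. Explicitly: for every field extension $K$ of $k$, every ideal of $K[[x,y]]$ in the homogeneous sub-cell of $E\,K[[x,y]]$ has unique such coordinates; and there are polynomials with coefficients in $k$, independent of $K$, which give for every $K$ a bijection between $K^D$ and the homogeneous sub-cell of $E\,K[[x,y]]$, the coordinates $a_{\mu,\nu}$ being polynomials in the $D$ parameters and the parameters being polynomials in the $a_{\mu,\nu}$. -/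

import Mathlib

/-! Gröbner cells of `k[[x,y]]` for a local term ordering.  The variables are `x = X 0`, `y = X 1`;
an exponent `d : Fin 2 →₀ ℕ` stands for the monomial `x ^ d 0 * y ^ d 1`. -/

open scoped MonomialOrder

noncomputable section

namespace LocalCell

universe u

/-- The ring `k[[x,y]]`. -/
abbrev PS (k : Type u) [CommRing k] : Type u := MvPowerSeries (Fin 2) k

/-- The exponent of `x ^ a * y ^ b`. -/
def expo (a b : ℕ) : Fin 2 →₀ ℕ := Finsupp.single 0 a + Finsupp.single 1 b

/-- The local (reverse-degree) ordering induced by the term ordering `τ`: the monomial with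
exponent `d` is strictly larger than the one with exponent `e` iff it has smaller degree, or the
same degree and is larger for `τ`. -/
def LocalGT (τ : MonomialOrder (Fin 2)) (d e : Fin 2 →₀ ℕ) : Prop :=
  d.degree < e.degree ∨ (d.degree = e.degree ∧ e ≺[τ] d)

section Cells

variable {k : Type u} [Field k]

/-- `d` is the exponent of the leading term of `f` for the local ordering: it occurs in `f` and is
strictly larger than every other exponent that occurs in `f`. -/
def IsLeadingExp (τ : MonomialOrder (Fin 2)) (f : PS k) (d : Fin 2 →₀ ℕ) : Prop :=
  MvPowerSeries.coeff d f ≠ 0 ∧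
    ∀ e, MvPowerSeries.coeff e f ≠ 0 → e ≠ d → LocalGT τ d e

/-- The leading term ideal of `J`, generated by the leading terms of the (nonzero) elements of `J`;
monomial ideals of `k[x,y]` are regarded as monomial ideals of `k[[x,y]]`. -/
def leadingTermIdeal (τ : MonomialOrder (Fin 2)) (J : Ideal (PS k)) : Ideal (PS k) :=
  Ideal.span {g | ∃ f ∈ J, ∃ d, IsLeadingExp τ f d ∧
    g = MvPowerSeries.monomial d (MvPowerSeries.coeff d f)}

/-- An ideal generated by monomials. -/
def IsMonomialIdeal (E : Ideal (PS k)) : Prop :=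
  ∃ S : Set (Fin 2 →₀ ℕ), E = Ideal.span ((fun d => MvPowerSeries.monomial d (1 : k)) '' S)

/-- The Gröbner cell `V(E)`: all ideals `J` whose leading term ideal is `E`. -/
def cell (τ : MonomialOrder (Fin 2)) (E : Ideal (PS k)) : Set (Ideal (PS k)) :=
  {J | leadingTermIdeal τ J = E}

/-- The initial form `f*`, the nonzero homogeneous component of lowest degree (`0` for `f = 0`). -/
def initialForm (f : PS k) : PS k :=
  MvPowerSeries.homogeneousComponent f.order.toNat f

/-- The initial ideal `J*`, generated by the initial forms of the elements of `J`. -/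
def initialIdeal (J : Ideal (PS k)) : Ideal (PS k) :=
  Ideal.span (initialForm '' (J : Set (PS k)))

/-- The homogeneous sub-cell `V_hom(E) = {J ∈ V(E) : J = J*}`. -/
def homCell (τ : MonomialOrder (Fin 2)) (E : Ideal (PS k)) : Set (Ideal (PS k)) :=
  {J | J ∈ cell τ E ∧ J = initialIdeal J}

/-! ### The staircase and the degree matrix of a monomial ideal
A zero-dimensional monomial ideal is `E = (x ^ t, …, x ^ (t - i) * y ^ m_i, …, y ^ m_t)` with
`0 = m_0 < m_1 ≤ … ≤ m_t`. -/

/-- `t`, the least exponent of a power of `x` in `E`. -/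
def xExp (E : Ideal (PS k)) : ℕ :=
  sInf {a | MvPowerSeries.monomial (expo a 0) (1 : k) ∈ E}

/-- `m_i` for `0 ≤ i ≤ t`, the least `b` with `x ^ (t - i) * y ^ b ∈ E`. -/
def yExp (E : Ideal (PS k)) (i : ℕ) : ℕ :=
  sInf {b | MvPowerSeries.monomial (expo (xExp E - i) b) (1 : k) ∈ E}

/-- `d_j = m_j - m_{j-1}` for `1 ≤ j ≤ t`. -/
def stepDeg (E : Ideal (PS k)) (j : ℕ) : ℤ :=
  (yExp E j : ℤ) - (yExp E (j - 1) : ℤ)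

/-- The entry `u_{i,j} = m_j - m_{i-1} + i - j` of the degree matrix, `1 ≤ i ≤ t + 1`,
`1 ≤ j ≤ t`. -/
def degEntry (E : Ideal (PS k)) (i j : ℕ) : ℤ :=
  (yExp E j : ℤ) - (yExp E (i - 1) : ℤ) + (i : ℤ) - (j : ℤ)

/-- The positions `(i,j)`, `1 ≤ i ≤ t + 1`, `1 ≤ j ≤ t`, with `i > j` and `0 ≤ u_{i,j} < d_j`. -/
def homPositions (E : Ideal (PS k)) : Finset (ℕ × ℕ) :=
  (Finset.Icc 1 (xExp E + 1) ×ˢ Finset.Icc 1 (xExp E)).filter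
    fun p => p.1 > p.2 ∧ 0 ≤ degEntry E p.1 p.2 ∧ degEntry E p.1 p.2 < stepDeg E p.2

end Cells

/-! ### Affine spaces inside the Hilbert scheme
Around `E` the Hilbert scheme has the standard affine chart of all ideals `J` such that the
monomials outside `E` form a basis modulo `J`.  The coordinates of `J` in this chart are the
coefficients `a m b` of the normal forms `x^m ≡ ∑_{b ∉ E} a m b * x^b` modulo `J`. -/

/-- `a` is a family of chart coordinates of `J`: each `a m`, read as a power series, involves only
monomials outside `E` and is congruent to the monomial `m` modulo `J`. -/
def IsChartCoord {k : Type u} [Field k] (E J : Ideal (PS k))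
    (a : (Fin 2 →₀ ℕ) → (Fin 2 →₀ ℕ) → k) : Prop :=
  ∀ m, (∀ b, MvPowerSeries.monomial b (1 : k) ∈ E → a m b = 0) ∧
    MvPowerSeries.monomial m (1 : k) - (show PS k from fun b => a m b) ∈ J

/-- The ideal generated by `E` in `K[[x,y]]`, for a field extension `K` of `k`. -/
def extend {k : Type u} [Field k] (K : Type u) [Field K] [Algebra k K] (E : Ideal (PS k)) :
    Ideal (PS K) :=
  E.map (MvPowerSeries.map (algebraMap k K))

/-- Let `Z K`, for each field extension `K` of `k` (in particular `K = k`, and `K` an algebraic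
closure of `k`), be a set of ideals of `K[[x,y]]`.  `Z`, with its structure of a reduced subvariety
of the Hilbert scheme, is an affine space of dimension `D` over `k`: it lies in the chart around
`E`, and there are polynomials `P`, `Q` over `k` such that for every `K` the points of `Z` over `K`
are in bijection with `K ^ D`, where the chart coordinates of an ideal are given by the polynomials
`P` in the parameters and the parameters by the polynomials `Q` in the chart coordinates. -/
def IsAffineSpaceOfDim {k : Type u} [Field k] (E : Ideal (PS k))
    (Z : ∀ (K : Type u) [Field K] [Algebra k K], Set (Ideal (PS K))) (D : ℕ) : Prop :=
  (∀ (K : Type u) [Field K] [Algebra k K], ∀ J ∈ Z K,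
    ∃! a : (Fin 2 →₀ ℕ) → (Fin 2 →₀ ℕ) → K, IsChartCoord (extend K E) J a) ∧
  ∃ (P : (Fin 2 →₀ ℕ) → (Fin 2 →₀ ℕ) → MvPolynomial (Fin D) k)
    (Q : Fin D → MvPolynomial ((Fin 2 →₀ ℕ) × (Fin 2 →₀ ℕ)) k),
    ∀ (K : Type u) [Field K] [Algebra k K], ∃ φ : (Fin D → K) ≃ Z K,
      (∀ c : Fin D → K,
        IsChartCoord (extend K E) (φ c : Ideal (PS K))
          (fun m b => MvPolynomial.aeval c (P m b))) ∧
      (∀ (J : Z K) (a : (Fin 2 →₀ ℕ) → (Fin 2 →₀ ℕ) → K),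
        IsChartCoord (extend K E) (J : Ideal (PS K)) a →
          ∀ s, φ.symm J s = MvPolynomial.aeval (fun p => a p.1 p.2) (Q s))

end LocalCell

end

/-! Setting `y = 1` turns a homogeneous ideal `J` into an increasing chain of spaces `W_d` of
polynomials of degree at most `d` in one variable `X`, with `X * W_d ⊆ W_(d+1)`; the inclusions are
multiplication by `y`. Since `x > y`, the leading monomial of a form of degree `d` is read off from
the `X`-degree of its dehomogenisation. With `e a` the least degree of a monomial `x^a y^b` in `E`,
membership in the cell says that the degrees occurring in `W_d` are exactly the `b` with `e b ≤ d`
(`HasStair`; `HasStair.mem_homCell`, `hasStair_of_mem_homCell`).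

Pick `f_a` monic of degree `a` in `W_(e a)`; the `f_b` with `e b ≤ d` form a basis of `W_d`. The
ideal property amounts to `X f_a = f_(a+1) + ∑ c_ab f_b` over `b ≤ a` with `e b ≤ e a + 1`. Terms
with `e b ≤ e (a+1)` can be absorbed into `f_(a+1)`, so `c` may be supported on `e (a+1) < e b ≤ e a
+ 1`. Every such `c` gives an ideal (`hasStair_stairIdeal`), and `c` is determined by it
(`stairIdeal_injective`). Reindexing these positions gives `D` (`card_homPositions`).

Polynomiality comes from doing the same algebra over polynomial rings and specialising. Chart
coordinates are normal forms modulo monic polynomials with generic `c` (`exists_normalForm`).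
Conversely, generic chart coordinates give monic `g_a`, and `exists_genSeq_eq_add_sum` extracts `c`
from them although generic `g_a` satisfy no ideal relations; `HasStair.genSeq_mem` shows that after
specialisation to an actual `J` the sequence of this `c` lies in `J`. -/

open scoped MonomialOrder

noncomputable section

namespace LocalCell

open Polynomial

universe u

/-! ### Monic polynomial sequences defined by recurrences, over an arbitrary commutative ring -/

section Sequences

variable {A : Type*} [CommRing A]

/-- `p` is monic of degree `a`; over the zero ring this carries no information. -/
def MonicAt (p : A[X]) (a : ℕ) : Prop :=
  p.coeff a = 1 ∧ ∀ n, a < n → p.coeff n = 0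

theorem monicAt_one : MonicAt (1 : A[X]) 0 :=
  ⟨by simp, fun n hn => by simp [coeff_one, hn.ne']⟩

/-- The sequence of polynomials with `f 0 = 1` and `f (a + 1) = X * f a - ∑ b ≤ a, c a b * f b`. -/
def genSeq (c : ℕ → ℕ → A) : ℕ → A[X]
  | 0 => 1
  | a + 1 => X * genSeq c a - ∑ b : Fin (a + 1), C (c a b) * genSeq c b
termination_by a => a
decreasing_by
  · exact Nat.lt_succ_self a
  · exact b.2

theorem genSeq_zero (c : ℕ → ℕ → A) : genSeq c 0 = 1 := by
  rw [genSeq]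

theorem genSeq_succ (c : ℕ → ℕ → A) (a : ℕ) :
    genSeq c (a + 1) = X * genSeq c a - ∑ b ∈ Finset.range (a + 1), C (c a b) * genSeq c b := by
  rw [genSeq, Finset.sum_range]

theorem genSeq_congr {c c' : ℕ → ℕ → A} {N : ℕ} (h : ∀ a < N, c a = c' a) {a : ℕ} (ha : a ≤ N) :
    genSeq c a = genSeq c' a := by
  induction a using Nat.strong_induction_on with
  | _ a ih =>
    cases a with
    | zero => rw [genSeq_zero, genSeq_zero]
    | succ a =>
      rw [genSeq_succ, genSeq_succ, ih a (by omega) (by omega), h a (by omega)]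
      congr 1
      refine Finset.sum_congr rfl fun b hb => ?_
      rw [Finset.mem_range] at hb
      rw [ih b hb (by omega)]

theorem genSeq_map {B : Type*} [CommRing B] (φ : A →+* B) (c : ℕ → ℕ → A) (a : ℕ) :
    (genSeq c a).map φ = genSeq (fun a b => φ (c a b)) a := by
  induction a using Nat.strong_induction_on with
  | _ a ih =>
    cases a with
    | zero => simp [genSeq_zero]
    | succ a =>
      rw [genSeq_succ, genSeq_succ, Polynomial.map_sub, Polynomial.map_mul, Polynomial.map_sum,
        map_X, ih a (by omega)]
      congr 1
      refine Finset.sum_congr rfl fun b hb => ?_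
      rw [Polynomial.map_mul, map_C, ih b (Finset.mem_range.1 hb)]

theorem monicAt_genSeq (c : ℕ → ℕ → A) (a : ℕ) : MonicAt (genSeq c a) a := by
  induction a using Nat.strong_induction_on with
  | _ a ih =>
    cases a with
    | zero => rw [genSeq_zero]; exact monicAt_one
    | succ a =>
      have key : ∀ n, a < n →
          (∑ b ∈ Finset.range (a + 1), C (c a b) * genSeq c b).coeff n = 0 := by
        intro n hn
        rw [finsetSum_coeff]
        refine Finset.sum_eq_zero fun b hb => ?_
        rw [Finset.mem_range] at hb
        rw [coeff_C_mul, (ih b hb).2 n (by omega), mul_zero]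
      rw [genSeq_succ]
      refine ⟨?_, fun n hn => ?_⟩
      · rw [coeff_sub, key _ (Nat.lt_succ_self a), coeff_X_mul, (ih a (by omega)).1, sub_zero]
      · obtain ⟨n, rfl⟩ : ∃ m, n = m + 1 := ⟨n - 1, by omega⟩
        rw [coeff_sub, key _ (by omega), coeff_X_mul, (ih a (by omega)).2 n (by omega), sub_zero]

theorem exists_eq_sum_of_monicAt {f : ℕ → A[X]} (hf : ∀ a, MonicAt (f a) a) (N : ℕ) (p : A[X])
    (hp : ∀ n, N ≤ n → p.coeff n = 0) :
    ∃ γ : ℕ → A, p = ∑ b ∈ Finset.range N, C (γ b) * f b := by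
  induction N generalizing p with
  | zero => exact ⟨0, by ext n; simp [hp n (Nat.zero_le n)]⟩
  | succ N ih =>
    obtain ⟨γ, hγ⟩ := ih (p - C (p.coeff N) * f N) (by
      intro n hn
      rcases hn.eq_or_lt with rfl | hn
      · simp [(hf N).1]
      · simp [hp n hn, (hf N).2 n hn])
    refine ⟨fun b => if b = N then p.coeff N else γ b, ?_⟩
    simp only [Finset.sum_range_succ, if_true]
    rw [← sub_eq_iff_eq_add, hγ]
    refine Finset.sum_congr rfl fun b hb => ?_
    rw [if_neg (Finset.mem_range.1 hb).ne]

theorem eq_zero_of_sum_eq_zero {f : ℕ → A[X]} (hf : ∀ a, MonicAt (f a) a) {N : ℕ} {γ : ℕ → A}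
    (h : ∑ b ∈ Finset.range N, C (γ b) * f b = 0) {b : ℕ} (hb : b < N) : γ b = 0 := by
  induction N with
  | zero => omega
  | succ N ih =>
    have hN : γ N = 0 := by
      have := congrArg (fun p => p.coeff N) h
      simp only [finsetSum_coeff, coeff_C_mul, coeff_zero] at this
      rw [Finset.sum_range_succ, (hf N).1, mul_one, Finset.sum_eq_zero, zero_add] at this
      · exact this
      · intro b hb
        rw [(hf b).2 N (Finset.mem_range.1 hb), mul_zero]
    rcases (Nat.lt_succ_iff.1 hb).eq_or_lt with rfl | hb
    · exact hN
    · refine ih ?_ hb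
      rwa [Finset.sum_range_succ, hN, C_0, zero_mul, add_zero] at h

/-- The `f b` have distinct degrees and leading coefficient `1`, so the term of largest index in a
combination cannot be cancelled. -/
theorem natDegree_mem_of_mem_span {f : ℕ → A[X]} (hf : ∀ a, MonicAt (f a) a) {S : Set ℕ}
    {p : A[X]} (hp : p ∈ Submodule.span A (f '' S)) (h0 : p ≠ 0) : p.natDegree ∈ S := by
  obtain ⟨l, hl, rfl⟩ := (Finsupp.mem_span_image_iff_linearCombination A).1 hp
  have hne : l.support.Nonempty := by
    rw [Finsupp.support_nonempty_iff]
    rintro rfl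
    simp at h0
  set m := l.support.max' hne with hm
  have hmem : m ∈ l.support := Finset.max'_mem _ _
  have hle : ∀ b ∈ l.support, b ≤ m := fun b hb => Finset.le_max' _ _ hb
  suffices h : (Finsupp.linearCombination A f l).natDegree = m by
    rw [h]; exact hl hmem
  rw [Finsupp.linearCombination_apply, Finsupp.sum]
  refine natDegree_eq_of_le_of_coeff_ne_zero ?_ ?_
  · rw [natDegree_le_iff_coeff_eq_zero]
    intro n hn
    rw [finsetSum_coeff]
    refine Finset.sum_eq_zero fun b hb => ?_
    rw [coeff_smul, (hf b).2 n (lt_of_le_of_lt (hle b hb) hn), smul_zero]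
  · rw [finsetSum_coeff, Finset.sum_eq_single m]
    · simpa [(hf m).1] using hmem
    · intro b hb hbm
      rw [coeff_smul, (hf b).2 m (lt_of_le_of_ne (hle b hb) hbm), smul_zero]
    · exact fun h => absurd hmem h

/-- Reduction from the top coefficient downwards. Only monic polynomials are subtracted, so nothing
is inverted and the argument applies over a ring of generic parameters. -/
theorem exists_normalForm {W : Submodule A A[X]} {S : Set ℕ}
    (hW : ∀ b ∈ S, ∃ f ∈ W, MonicAt f b) (N : ℕ) (p : A[X]) (hp : ∀ n, N ≤ n → p.coeff n = 0) :
    ∃ r : A[X], (∀ b ∈ S, r.coeff b = 0) ∧ (∀ n, N ≤ n → r.coeff n = 0) ∧ p - r ∈ W := by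
  induction N generalizing p with
  | zero =>
    have : p = 0 := by ext n; simp [hp n (Nat.zero_le n)]
    exact ⟨0, by simp, by simp, by simp [this]⟩
  | succ N ih =>
    by_cases hN : N ∈ S
    · obtain ⟨f, hf, hfN⟩ := hW N hN
      obtain ⟨r, h1, h2, h3⟩ := ih (p - C (p.coeff N) * f) (by
        intro n hn
        rcases hn.eq_or_lt with rfl | hn
        · simp [hfN.1]
        · simp [hp n hn, hfN.2 n hn])
      refine ⟨r, h1, fun n hn => h2 n (by omega), ?_⟩
      have := W.add_mem h3 (W.smul_mem (p.coeff N) hf)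
      rw [smul_eq_C_mul] at this
      convert this using 1
      ring
    · obtain ⟨r, h1, h2, h3⟩ := ih (p - monomial N (p.coeff N)) (by
        intro n hn
        rcases hn.eq_or_lt with rfl | hn
        · simp
        · simp [hp n hn, coeff_monomial, hn.ne])
      refine ⟨r + monomial N (p.coeff N), ?_, ?_, ?_⟩
      · intro b hb
        have : N ≠ b := by rintro rfl; exact hN hb
        simp [h1 b hb, coeff_monomial, this]
      · intro n hn
        have : N ≠ n := by omega
        simp [h2 n (by omega), coeff_monomial, this]
      · convert h3 using 1
        ring

/-- The normal form modulo `W` of an element of `V` stays in `V`; its leading coefficient sits at a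
position where normal forms vanish, so it is zero. -/
theorem le_of_natDegree_mem {V W : Submodule A A[X]} {S : Set ℕ}
    (hW : ∀ b ∈ S, ∃ f ∈ W, MonicAt f b) (hWV : W ≤ V)
    (hV : ∀ p ∈ V, p ≠ 0 → p.natDegree ∈ S) : V ≤ W := by
  intro p hp
  obtain ⟨r, h1, -, h3⟩ := exists_normalForm hW (p.natDegree + 1) p
    fun n hn => coeff_eq_zero_of_natDegree_lt hn
  have hr : r ∈ V := by
    have := V.sub_mem hp (hWV h3)
    rwa [sub_sub_cancel] at this
  have : r = 0 := by
    by_contra h0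
    exact h0 (leadingCoeff_eq_zero.1 (h1 _ (hV r hr h0)))
  rwa [this, sub_zero] at h3

/-- Expand `X * f a - g (a + 1)` in the basis `f b`; the coefficients at positions in `ps` go into
`c`, the others remain as the error `h`. No relation among the `g a` is needed, so this applies to
generic `g`. -/
theorem exists_genSeq_eq_add_sum {g : ℕ → A[X]} (hg : ∀ a, MonicAt (g a) a)
    (ps : ℕ → ℕ → Prop) (N : ℕ) (hps : ∀ a b, ps a b → a < N) :
    ∃ c : ℕ → ℕ → A, (∀ a b, ¬ ps a b → c a b = 0) ∧
      ∃ h : ℕ → ℕ → A, (∀ a b, ps a b → h a b = 0) ∧ ∀ a,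
        genSeq c (a + 1) = g (a + 1) + ∑ b ∈ Finset.range (a + 1), C (h a b) * genSeq c b := by
  classical
  have step : ∀ M : ℕ, ∃ c : ℕ → ℕ → A, (∀ a b, ¬ (ps a b ∧ a < M) → c a b = 0) ∧
      ∀ a < M, ∃ h : ℕ → A, (∀ b, ps a b → h b = 0) ∧
        genSeq c (a + 1) = g (a + 1) + ∑ b ∈ Finset.range (a + 1), C (h b) * genSeq c b := by
    intro M
    induction M with
    | zero => exact ⟨fun _ _ => 0, fun _ _ _ => rfl, fun a ha => absurd ha (by omega)⟩
    | succ M ih =>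
      obtain ⟨c, hc0, hc⟩ := ih
      -- Both polynomials are monic of degree `M + 1`, so their difference involves only `f 0, …, f
      -- M`, which do not depend on row `M` of `c`.
      obtain ⟨γ, hγ⟩ := exists_eq_sum_of_monicAt (monicAt_genSeq c) (M + 1)
        (X * genSeq c M - g (M + 1)) (by
          intro n hn
          obtain ⟨n, rfl⟩ : ∃ m, n = m + 1 := ⟨n - 1, by omega⟩
          rw [coeff_sub, coeff_X_mul]
          rcases hn.eq_or_lt with hn | hn
          · obtain rfl : M = n := by omega
            rw [(monicAt_genSeq c M).1, (hg (M + 1)).1, sub_self]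
          · rw [(monicAt_genSeq c M).2 _ (by omega), (hg (M + 1)).2 _ hn, sub_self])
      set c' : ℕ → ℕ → A := Function.update c M fun b => if ps M b then γ b else 0 with hc'
      have hagree : ∀ a, a ≠ M → c' a = c a := fun a ha => by rw [hc', Function.update_of_ne ha]
      have hself : ∀ b, c' M b = if ps M b then γ b else 0 := fun b => by
        rw [hc', Function.update_self]
      have hseq : ∀ a ≤ M, genSeq c' a = genSeq c a := fun a ha =>
        genSeq_congr (fun j hj => hagree j hj.ne) ha
      refine ⟨c', fun a b hab => ?_, fun a ha => ?_⟩
      · by_cases haM : a = M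
        · subst haM
          rw [hself, if_neg fun h => hab ⟨h, Nat.lt_succ_self a⟩]
        · rw [hagree a haM]
          exact hc0 a b fun h => hab ⟨h.1, h.2.trans (Nat.lt_succ_self M)⟩
      · rcases (Nat.lt_succ_iff.1 ha).eq_or_lt with rfl | ha
        · refine ⟨fun b => if ps a b then 0 else γ b, fun b hb => if_pos hb, ?_⟩
          rw [genSeq_succ, hseq a le_rfl, sub_eq_iff_eq_add, add_assoc, ← sub_eq_iff_eq_add', hγ,
            ← Finset.sum_add_distrib]
          refine Finset.sum_congr rfl fun b hb => ?_
          rw [Finset.mem_range] at hb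
          rw [hself, hseq b (by omega), ← add_mul, ← C_add]
          by_cases hab : ps a b <;> simp [hab]
        · obtain ⟨h, h0, h1⟩ := hc a ha
          refine ⟨h, h0, ?_⟩
          rw [hseq _ ha, h1]
          congr 1
          refine Finset.sum_congr rfl fun b hb => ?_
          rw [Finset.mem_range] at hb
          rw [hseq b (by omega)]
  obtain ⟨c, hc0, hc⟩ := step N
  refine ⟨c, fun a b hab => hc0 a b fun h => hab h.1, ?_⟩
  have : ∀ a, ∃ h : ℕ → A, (∀ b, ps a b → h b = 0) ∧
      genSeq c (a + 1) = g (a + 1) + ∑ b ∈ Finset.range (a + 1), C (h b) * genSeq c b := by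
    intro a
    by_cases ha : a < N
    · exact hc a ha
    -- Rows from `N` on contain no position of `ps`, so the whole difference may be put into `h`.
    · obtain ⟨γ, hγ⟩ := exists_eq_sum_of_monicAt (monicAt_genSeq c) (a + 1)
        (genSeq c (a + 1) - g (a + 1)) (by
          intro n hn
          rw [coeff_sub]
          rcases hn.eq_or_lt with rfl | hn
          · rw [(monicAt_genSeq c (a + 1)).1, (hg (a + 1)).1, sub_self]
          · rw [(monicAt_genSeq c (a + 1)).2 _ hn, (hg (a + 1)).2 _ hn, sub_self])
      exact ⟨γ, fun b hb => absurd (hps a b hb) ha, by rw [← hγ]; ring⟩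
  choose h h0 h1 using this
  exact ⟨h, h0, h1⟩

/-! ### Staircases, free positions and the filtration they define -/

/-- The ordinates `e a` record, for each power `x ^ a`, the degree of the first multiple by a power
of `y` in a staircase, which contains `x ^ t`. -/
structure IsStair (e : ℕ → ℕ) (t : ℕ) : Prop where
  le_self : ∀ a, a ≤ e a
  succ_le : ∀ a, e (a + 1) ≤ e a + 1
  eq_self : ∀ a, t ≤ a → e a = a

/-- The positions of the free parameters. -/
def FreePos (e : ℕ → ℕ) (a b : ℕ) : Prop :=
  b ≤ a ∧ e (a + 1) < e b ∧ e b ≤ e a + 1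

theorem IsStair.lt_of_freePos {e : ℕ → ℕ} {t : ℕ} (he : IsStair e t) {a b : ℕ}
    (h : FreePos e a b) : a < t := by
  by_contra hat
  have h1 := he.eq_self a (by omega)
  have h2 := he.eq_self (a + 1) (by omega)
  obtain ⟨-, h3, h4⟩ := h
  omega

/-- The span of the `f b` with `e b ≤ d`. -/
def stairSpan (e : ℕ → ℕ) (f : ℕ → A[X]) (d : ℕ) : Submodule A A[X] :=
  Submodule.span A (f '' {b | e b ≤ d})

theorem mem_stairSpan {e : ℕ → ℕ} (f : ℕ → A[X]) {b d : ℕ} (h : e b ≤ d) :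
    f b ∈ stairSpan e f d :=
  Submodule.subset_span ⟨b, h, rfl⟩

theorem stairSpan_mono (e : ℕ → ℕ) (f : ℕ → A[X]) : Monotone (stairSpan e f) :=
  fun _ _ h => Submodule.span_mono (Set.image_mono fun _ hb => le_trans hb h)

theorem C_mul_mem {W : Submodule A A[X]} (r : A) {p : A[X]} (hp : p ∈ W) : C r * p ∈ W := by
  rw [← smul_eq_C_mul]
  exact W.smul_mem r hp

/-- The recurrence expresses `X * f a` through `f (a + 1)` and the `f b` at free positions; `e (a +
1) ≤ e a + 1` and `e b ≤ e a + 1` place them all one step up the filtration. -/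
theorem X_mul_mem_stairSpan {e : ℕ → ℕ} {t : ℕ} (he : IsStair e t) {c : ℕ → ℕ → A}
    (hc : ∀ a b, ¬ FreePos e a b → c a b = 0) {d : ℕ} {p : A[X]}
    (hp : p ∈ stairSpan e (genSeq c) d) : X * p ∈ stairSpan e (genSeq c) (d + 1) := by
  have : stairSpan e (genSeq c) d ≤
      (stairSpan e (genSeq c) (d + 1)).comap (LinearMap.mulLeft A (X : A[X])) := by
    refine Submodule.span_le.2 ?_
    rintro _ ⟨a, ha, rfl⟩
    change e a ≤ d at ha
    have hs := genSeq_succ c a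
    rw [eq_sub_iff_add_eq] at hs
    change X * genSeq c a ∈ stairSpan e (genSeq c) (d + 1)
    rw [← hs]
    refine Submodule.add_mem _ (mem_stairSpan _ ((he.succ_le a).trans (by omega)))
      (Submodule.sum_mem _ fun b _ => ?_)
    by_cases hab : FreePos e a b
    · exact C_mul_mem _ (mem_stairSpan _ (hab.2.2.trans (by omega)))
    · simp [hc a b hab]
  exact this hp

theorem mul_mem_stairSpan {e : ℕ → ℕ} {t : ℕ} (he : IsStair e t) {c : ℕ → ℕ → A}
    (hc : ∀ a b, ¬ FreePos e a b → c a b = 0) {i d : ℕ} {q p : A[X]} (hq : q.natDegree ≤ i)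
    (hp : p ∈ stairSpan e (genSeq c) d) : q * p ∈ stairSpan e (genSeq c) (i + d) := by
  have hX : ∀ n, X ^ n * p ∈ stairSpan e (genSeq c) (n + d) := by
    intro n
    induction n with
    | zero => simpa using hp
    | succ n ih =>
      have := X_mul_mem_stairSpan he hc ih
      rw [← mul_assoc, ← pow_succ'] at this
      convert this using 2
      omega
  rw [q.as_sum_range_C_mul_X_pow, Finset.sum_mul]
  refine Submodule.sum_mem _ fun n hn => ?_
  rw [Finset.mem_range] at hn
  rw [mul_assoc]
  exact C_mul_mem _ (stairSpan_mono _ _ (by omega) (hX n))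

end Sequences

/-! ### Exponents in two variables -/

@[simp] theorem expo_zero (a b : ℕ) : expo a b 0 = a := by simp [expo]

@[simp] theorem expo_one (a b : ℕ) : expo a b 1 = b := by simp [expo]

theorem degree_eq_add (d : Fin 2 →₀ ℕ) : d.degree = d 0 + d 1 := by
  rw [Finsupp.degree_eq_sum, Fin.sum_univ_two]

@[simp] theorem degree_expo (a b : ℕ) : (expo a b).degree = a + b := by simp [degree_eq_add]

theorem expo_ext {d e : Fin 2 →₀ ℕ} (h0 : d 0 = e 0) (h1 : d 1 = e 1) : d = e := by
  ext i
  fin_cases i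
  · exact h0
  · exact h1

theorem expo_self (d : Fin 2 →₀ ℕ) : expo (d 0) (d 1) = d :=
  expo_ext (by simp) (by simp)

theorem expo_le_iff {d e : Fin 2 →₀ ℕ} : d ≤ e ↔ d 0 ≤ e 0 ∧ d 1 ≤ e 1 := by
  rw [Finsupp.le_def, Fin.forall_fin_two]

/-- The exponents of degree `d`. -/
def degreeFinset (d : ℕ) : Finset (Fin 2 →₀ ℕ) := Finset.finsuppAntidiag Finset.univ d

@[simp] theorem mem_degreeFinset {d : ℕ} {e : Fin 2 →₀ ℕ} :
    e ∈ degreeFinset d ↔ e.degree = d := by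
  simp [degreeFinset, Finset.mem_finsuppAntidiag, degree_eq_add]

/-! ### Homogeneous components, dehomogenisation and monomial ideals -/

section PowerSeries

variable {K : Type u} [CommRing K]

/-- The degree `d` part of a power series with `y` set to `1`. -/
def dehom (d : ℕ) : PS K →ₗ[K] K[X] :=
  ∑ e ∈ degreeFinset d, (Polynomial.monomial (e 0)).comp (MvPowerSeries.coeff e)

theorem dehom_apply (d : ℕ) (F : PS K) :
    dehom d F = ∑ e ∈ degreeFinset d, Polynomial.monomial (e 0) (MvPowerSeries.coeff e F) := by
  simp [dehom]

theorem coeff_dehom (d : ℕ) (F : PS K) (n : ℕ) :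
    (dehom d F).coeff n = if n ≤ d then MvPowerSeries.coeff (expo n (d - n)) F else 0 := by
  rw [dehom_apply, finsetSum_coeff]
  split_ifs with h
  · rw [Finset.sum_eq_single (expo n (d - n))]
    · simp
    · intro e he hne
      rw [mem_degreeFinset, degree_eq_add] at he
      rw [coeff_monomial, if_neg]
      rintro rfl
      exact hne (expo_ext (by simp) (by simp; omega))
    · intro h'
      exact absurd (by simp; omega) h'
  · refine Finset.sum_eq_zero fun e he => ?_
    rw [mem_degreeFinset, degree_eq_add] at he
    rw [coeff_monomial, if_neg]
    omega

theorem coeff_eq_coeff_dehom (F : PS K) (e : Fin 2 →₀ ℕ) :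
    MvPowerSeries.coeff e F = (dehom e.degree F).coeff (e 0) := by
  have h := degree_eq_add e
  rw [coeff_dehom, if_pos (by omega), h, Nat.add_sub_cancel_left, expo_self]

theorem natDegree_dehom_le (d : ℕ) (F : PS K) : (dehom d F).natDegree ≤ d := by
  rw [natDegree_le_iff_coeff_eq_zero]
  intro n hn
  rw [coeff_dehom, if_neg (by omega)]

theorem ext_dehom {F G : PS K} (h : ∀ d, dehom d F = dehom d G) : F = G := by
  refine MvPowerSeries.ext fun e => ?_
  rw [coeff_eq_coeff_dehom, coeff_eq_coeff_dehom, h]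

theorem dehom_mul (d : ℕ) (F G : PS K) :
    dehom d (F * G) = ∑ p ∈ Finset.HasAntidiagonal.antidiagonal d, dehom p.1 F * dehom p.2 G := by
  simp only [dehom_apply, Finset.sum_mul_sum, MvPowerSeries.coeff_mul, map_sum,
    ← Finset.sum_product', monomial_mul_monomial]
  rw [Finset.sum_sigma', Finset.sum_sigma']
  refine Finset.sum_bij' (fun x _ => ⟨(x.2.1.degree, x.2.2.degree), x.2⟩)
    (fun x _ => ⟨x.2.1 + x.2.2, x.2⟩) ?_ ?_ ?_ ?_ ?_
  · rintro ⟨e, p, q⟩ h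
    simp only [Finset.mem_sigma, mem_degreeFinset, Finset.HasAntidiagonal.mem_antidiagonal] at h
    obtain ⟨h1, rfl⟩ := h
    simpa using h1
  · rintro ⟨⟨i, j⟩, p, q⟩ h
    simp only [Finset.mem_sigma, mem_degreeFinset, Finset.HasAntidiagonal.mem_antidiagonal,
      Finset.mem_product] at h
    obtain ⟨h1, rfl, rfl⟩ := h
    simpa using h1
  · rintro ⟨e, p, q⟩ h
    simp only [Finset.mem_sigma, mem_degreeFinset, Finset.HasAntidiagonal.mem_antidiagonal] at h
    obtain ⟨h1, rfl⟩ := h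
    rfl
  · rintro ⟨⟨i, j⟩, p, q⟩ h
    simp only [Finset.mem_sigma, mem_degreeFinset, Finset.HasAntidiagonal.mem_antidiagonal,
      Finset.mem_product] at h
    obtain ⟨h1, rfl, rfl⟩ := h
    rfl
  · rintro ⟨e, p, q⟩ h
    simp only [Finset.mem_sigma, mem_degreeFinset, Finset.HasAntidiagonal.mem_antidiagonal] at h
    obtain ⟨h1, rfl⟩ := h
    rfl

/-- The homogenisation of degree `d` of a polynomial of degree at most `d`. -/
def hom (d : ℕ) (p : K[X]) : PS K := fun e => if e.degree = d then p.coeff (e 0) else 0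

theorem coeff_hom (d : ℕ) (p : K[X]) (e : Fin 2 →₀ ℕ) :
    MvPowerSeries.coeff e (hom d p) = if e.degree = d then p.coeff (e 0) else 0 := rfl

theorem dehom_hom {d : ℕ} {p : K[X]} (hp : p.natDegree ≤ d) : dehom d (hom d p) = p := by
  ext n
  rw [coeff_dehom, coeff_hom]
  split_ifs with h1 h2
  · simp
  · simp at h2
    omega
  · rw [coeff_eq_zero_of_natDegree_lt (by omega)]

theorem dehom_hom_of_ne {d d' : ℕ} (p : K[X]) (h : d' ≠ d) : dehom d' (hom d p) = 0 := by
  ext n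
  rw [coeff_dehom, coeff_hom]
  split_ifs with h1 h2
  · simp at h2
    omega
  · rfl
  · rfl

theorem homogeneousComponent_eq (d : ℕ) (F : PS K) :
    MvPowerSeries.homogeneousComponent d F = hom d (dehom d F) := by
  refine MvPowerSeries.ext fun e => ?_
  rw [MvPowerSeries.coeff_homogeneousComponent, coeff_hom]
  split_ifs with h
  · rw [coeff_eq_coeff_dehom, h]
  · rfl

theorem hom_zero (d : ℕ) : hom d (0 : K[X]) = 0 := by
  refine MvPowerSeries.ext fun e => ?_
  simp [coeff_hom]

theorem hom_add (d : ℕ) (p q : K[X]) : hom d (p + q) = hom d p + hom d q := by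
  refine MvPowerSeries.ext fun e => ?_
  rw [map_add, coeff_hom, coeff_hom, coeff_hom]
  split_ifs <;> simp

theorem hom_sub (d : ℕ) (p q : K[X]) : hom d (p - q) = hom d p - hom d q := by
  rw [eq_sub_iff_add_eq, ← hom_add, sub_add_cancel]

theorem hom_sum {ι : Type*} (s : Finset ι) (d : ℕ) (p : ι → K[X]) :
    hom d (∑ i ∈ s, p i) = ∑ i ∈ s, hom d (p i) := by
  classical
  induction s using Finset.induction_on with
  | empty => simp [hom_zero]
  | insert i s hi ih => rw [Finset.sum_insert hi, Finset.sum_insert hi, hom_add, ih]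

theorem hom_mul {i j : ℕ} {p q : K[X]} (hp : p.natDegree ≤ i) (hq : q.natDegree ≤ j) :
    hom (i + j) (p * q) = hom i p * hom j q := by
  refine ext_dehom fun d => ?_
  rw [dehom_mul]
  by_cases hd : d = i + j
  · subst hd
    rw [dehom_hom (natDegree_mul_le.trans (add_le_add hp hq)), Finset.sum_eq_single (i, j)]
    · rw [dehom_hom hp, dehom_hom hq]
    · rintro ⟨i', j'⟩ h hne
      rw [Finset.HasAntidiagonal.mem_antidiagonal] at h
      dsimp only at h ⊢
      by_cases hi : i' = i
      · rw [dehom_hom_of_ne q (d := j) (by rintro rfl; exact hne (by rw [hi])), mul_zero]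
      · rw [dehom_hom_of_ne p hi, zero_mul]
    · intro h
      exact absurd (by simp) h
  · rw [dehom_hom_of_ne _ hd]
    refine (Finset.sum_eq_zero ?_).symm
    rintro ⟨i', j'⟩ h
    rw [Finset.HasAntidiagonal.mem_antidiagonal] at h
    dsimp only at h ⊢
    by_cases hi : i' = i
    · rw [dehom_hom_of_ne q (d := j) (by omega), mul_zero]
    · rw [dehom_hom_of_ne p hi, zero_mul]

theorem monomial_eq_hom (e : Fin 2 →₀ ℕ) (r : K) :
    MvPowerSeries.monomial e r = hom e.degree (Polynomial.monomial (e 0) r) := by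
  classical
  refine MvPowerSeries.ext fun e' => ?_
  rw [MvPowerSeries.coeff_monomial, coeff_hom, coeff_monomial, ← ite_and]
  refine if_congr ?_ rfl rfl
  rw [degree_eq_add, degree_eq_add]
  constructor
  · rintro rfl
    exact ⟨rfl, rfl⟩
  · rintro ⟨h1, h2⟩
    exact expo_ext h2.symm (by omega)

/-- A power series of order at least `N` is a finite combination of the monomials of degree `N`:
each exponent `e` is assigned to the single divisor `x^a y^(N-a)` with `a = min (e 0) N`. -/
theorem mem_of_coeff_eq_zero {I : Ideal (PS K)} {N : ℕ}
    (hI : ∀ e : Fin 2 →₀ ℕ, e.degree = N → MvPowerSeries.monomial e (1 : K) ∈ I) {F : PS K}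
    (hF : ∀ e : Fin 2 →₀ ℕ, e.degree < N → MvPowerSeries.coeff e F = 0) : F ∈ I := by
  classical
  -- Here `e` is the exponent of the cofactor; the condition says that `a` is the minimum of `N` and
  -- the total `x`-exponent, so no term is counted twice.
  let G : ℕ → PS K := fun a e =>
    if a = N ∨ e 0 = 0 then MvPowerSeries.coeff (e + expo a (N - a)) F else 0
  have hG : ∀ a e, MvPowerSeries.coeff e (G a) =
    if a = N ∨ e 0 = 0 then MvPowerSeries.coeff (e + expo a (N - a)) F else 0 := fun _ _ => rfl
  have : F = ∑ a ∈ Finset.range (N + 1), MvPowerSeries.monomial (expo a (N - a)) 1 * G a := by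
    refine MvPowerSeries.ext fun e => ?_
    rw [map_sum]
    by_cases he : e.degree < N
    · rw [hF e he, Finset.sum_eq_zero]
      intro a ha
      rw [Finset.mem_range] at ha
      rw [degree_eq_add] at he
      rw [MvPowerSeries.coeff_monomial_mul, if_neg]
      rw [expo_le_iff, expo_zero, expo_one]
      omega
    · rw [degree_eq_add] at he
      rw [Finset.sum_eq_single (min (e 0) N)]
      · have hle : expo (min (e 0) N) (N - min (e 0) N) ≤ e := by
          rw [expo_le_iff, expo_zero, expo_one]
          omega
        rw [MvPowerSeries.coeff_monomial_mul, if_pos hle, one_mul, hG, if_pos,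
          tsub_add_cancel_of_le hle]
        rw [Finsupp.tsub_apply, expo_zero]
        omega
      · intro a ha hne
        rw [Finset.mem_range] at ha
        rw [MvPowerSeries.coeff_monomial_mul]
        split_ifs with h
        · rw [expo_le_iff, expo_zero, expo_one] at h
          rw [one_mul, hG, if_neg]
          rw [Finsupp.tsub_apply, expo_zero]
          omega
        · rfl
      · intro h
        exact absurd (Finset.mem_range.2 (by omega)) h
  rw [this]
  refine Ideal.sum_mem _ fun a ha => Ideal.mul_mem_right _ _ (hI _ ?_)
  rw [Finset.mem_range] at ha
  rw [degree_expo]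
  omega

/-- An ideal containing all monomials of degree `N` absorbs the tail of a power series, which
removes the convergence issue in summing infinitely many components. -/
theorem mem_of_hom_dehom_mem {I : Ideal (PS K)} {N : ℕ}
    (hI : ∀ e : Fin 2 →₀ ℕ, e.degree = N → MvPowerSeries.monomial e (1 : K) ∈ I) {F : PS K}
    (hF : ∀ d, hom d (dehom d F) ∈ I) : F ∈ I := by
  have h : F - ∑ d ∈ Finset.range N, hom d (dehom d F) ∈ I := by
    refine mem_of_coeff_eq_zero hI fun e he => ?_
    rw [map_sub, map_sum, Finset.sum_eq_single e.degree]
    · rw [coeff_hom, if_pos rfl, ← coeff_eq_coeff_dehom, sub_self]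
    · intro d _ hne
      rw [coeff_hom, if_neg hne.symm]
    · intro h
      exact absurd (Finset.mem_range.2 he) h
  have h' := I.add_mem h (Ideal.sum_mem I (t := Finset.range N) fun d _ => hF d)
  rwa [sub_add_cancel] at h'

/-- An ideal generated by homogeneous elements contains the homogeneous components of its
elements. -/
theorem hom_dehom_mem_span {s : Set (PS K)}
    (hs : ∀ G ∈ s, ∃ n, ∀ d, d ≠ n → dehom d G = 0) {F : PS K} (hF : F ∈ Ideal.span s) (d : ℕ) :
    hom d (dehom d F) ∈ Ideal.span s := by
  induction hF using Submodule.span_induction generalizing d with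
  | mem G hG =>
    obtain ⟨n, hn⟩ := hs G hG
    by_cases hd : d = n
    · subst hd
      have : hom d (dehom d G) = G := by
        refine ext_dehom fun d' => ?_
        by_cases h : d' = d
        · rw [h, dehom_hom (natDegree_dehom_le _ _)]
        · rw [dehom_hom_of_ne _ h, hn _ h]
      rw [this]
      exact Ideal.subset_span hG
    · rw [hn d hd, hom_zero]
      exact Ideal.zero_mem _
  | zero => rw [map_zero, hom_zero]; exact Ideal.zero_mem _
  | add F G _ _ hF hG => rw [map_add, hom_add]; exact Ideal.add_mem _ (hF d) (hG d)
  | smul H F _ hF =>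
    rw [smul_eq_mul, dehom_mul, hom_sum]
    refine Ideal.sum_mem _ fun p hp => ?_
    rw [Finset.HasAntidiagonal.mem_antidiagonal] at hp
    rw [← hp, hom_mul (natDegree_dehom_le _ _) (natDegree_dehom_le _ _)]
    exact Ideal.mul_mem_left _ _ (hF p.2)

theorem exists_le_of_mem_span_monomial {S : Set (Fin 2 →₀ ℕ)} {s : Set (PS K)}
    (hs : ∀ g ∈ s, ∃ d ∈ S, ∃ r, g = MvPowerSeries.monomial d r) {F : PS K}
    (hF : F ∈ Ideal.span s) {e : Fin 2 →₀ ℕ} (he : MvPowerSeries.coeff e F ≠ 0) :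
    ∃ d ∈ S, d ≤ e := by
  classical
  induction hF using Submodule.span_induction generalizing e with
  | mem g hg =>
    obtain ⟨d, hd, r, rfl⟩ := hs g hg
    rw [MvPowerSeries.coeff_monomial] at he
    obtain rfl : e = d := by
      by_contra h
      exact he (if_neg h)
    exact ⟨e, hd, le_rfl⟩
  | zero => simp at he
  | add F G _ _ hF hG =>
    rw [map_add] at he
    by_cases h : MvPowerSeries.coeff e F = 0
    · rw [h, zero_add] at he
      exact hG he
    · exact hF h
  | smul H F _ hF =>
    rw [smul_eq_mul, MvPowerSeries.coeff_mul] at he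
    obtain ⟨p, hp, hne⟩ := Finset.exists_ne_zero_of_sum_ne_zero he
    obtain ⟨d, hd, hle⟩ := hF (right_ne_zero_of_mul hne)
    rw [Finset.HasAntidiagonal.mem_antidiagonal] at hp
    exact ⟨d, hd, hle.trans (hp ▸ le_add_self)⟩

theorem monomial_mem_span_iff [Nontrivial K] {S : Set (Fin 2 →₀ ℕ)} {e : Fin 2 →₀ ℕ} :
    MvPowerSeries.monomial e (1 : K) ∈
      Ideal.span ((fun d => MvPowerSeries.monomial d (1 : K)) '' S) ↔ ∃ d ∈ S, d ≤ e := by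
  classical
  constructor
  · intro h
    refine exists_le_of_mem_span_monomial (S := S) ?_ h (e := e) (by simp)
    rintro _ ⟨d, hd, rfl⟩
    exact ⟨d, hd, 1, rfl⟩
  · rintro ⟨d, hd, hle⟩
    have : MvPowerSeries.monomial e (1 : K) =
        MvPowerSeries.monomial (e - d) 1 * MvPowerSeries.monomial d 1 := by
      rw [MvPowerSeries.monomial_mul_monomial, tsub_add_cancel_of_le hle, one_mul]
    rw [this]
    exact Ideal.mul_mem_left _ _ (Ideal.subset_span ⟨d, hd, rfl⟩)

end PowerSeries

/-! ### Leading exponents and initial forms through dehomogenisation -/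

/-- After removing a common factor, two monomials of equal degree become `x^n` and `y^n`. This is
the only point where `τ` is compared: within a degree it is ordering by the power of `x`. -/
theorem lt_of_degree_eq {τ : MonomialOrder (Fin 2)}
    (hτ : Finsupp.single 1 1 ≺[τ] Finsupp.single 0 1) {d e : Fin 2 →₀ ℕ}
    (h : d.degree = e.degree) (h0 : e 0 < d 0) : e ≺[τ] d := by
  rw [degree_eq_add, degree_eq_add] at h
  have hd : d = expo (e 0) (d 1) + (d 0 - e 0) • Finsupp.single 0 1 :=
    expo_ext (by simp; omega) (by simp)
  have he : e = expo (e 0) (d 1) + (d 0 - e 0) • Finsupp.single 1 1 :=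
    expo_ext (by simp) (by simp; omega)
  rw [hd, he, map_add, map_add, map_nsmul, map_nsmul, ← he]
  exact add_lt_add_right (nsmul_lt_nsmul_right (by omega) hτ) _

section

variable {K : Type u} [Field K] {τ : MonomialOrder (Fin 2)}

theorem IsLeadingExp.coeff_dehom_ne_zero {F : PS K} {d : Fin 2 →₀ ℕ} (h : IsLeadingExp τ F d) :
    (dehom d.degree F).coeff (d 0) ≠ 0 := by
  rw [← coeff_eq_coeff_dehom]
  exact h.1

theorem IsLeadingExp.coeff_dehom_eq_zero (hτ : Finsupp.single 1 1 ≺[τ] Finsupp.single 0 1)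
    {F : PS K} {d : Fin 2 →₀ ℕ} (h : IsLeadingExp τ F d) {n : ℕ} (hn : d 0 < n) :
    (dehom d.degree F).coeff n = 0 := by
  rw [coeff_dehom]
  split_ifs with hle
  · by_contra hne
    have hdeg : (expo n (d.degree - n)).degree = d.degree := by
      rw [degree_expo]
      omega
    rcases h.2 _ hne (by rintro heq; rw [← heq, expo_zero] at hn; exact hn.false) with h1 | h1
    · omega
    · exact lt_asymm h1.2 (lt_of_degree_eq hτ hdeg (by rwa [expo_zero]))
  · rfl

theorem IsLeadingExp.natDegree_dehom (hτ : Finsupp.single 1 1 ≺[τ] Finsupp.single 0 1)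
    {F : PS K} {d : Fin 2 →₀ ℕ} (h : IsLeadingExp τ F d) :
    (dehom d.degree F).natDegree = d 0 :=
  natDegree_eq_of_le_of_coeff_ne_zero
    (natDegree_le_iff_coeff_eq_zero.2 fun _ hn => h.coeff_dehom_eq_zero hτ hn)
    h.coeff_dehom_ne_zero

theorem isLeadingExp_hom (hτ : Finsupp.single 1 1 ≺[τ] Finsupp.single 0 1) {p : K[X]}
    {d : Fin 2 →₀ ℕ} (h0 : p.coeff (d 0) ≠ 0) (h : ∀ n, d 0 < n → p.coeff n = 0) :
    IsLeadingExp τ (hom d.degree p) d := by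
  refine ⟨by rwa [coeff_hom, if_pos rfl], fun e he hne => ?_⟩
  rw [coeff_hom] at he
  have hdeg : e.degree = d.degree := by
    by_contra hd
    exact he (if_neg hd)
  rw [if_pos hdeg] at he
  refine Or.inr ⟨hdeg.symm, lt_of_degree_eq hτ hdeg.symm (lt_of_le_of_ne ?_ fun heq => hne ?_)⟩
  · by_contra hlt
    exact he (h _ (by omega))
  · rw [degree_eq_add, degree_eq_add] at hdeg
    exact expo_ext heq (by omega)

theorem initialForm_eq_hom (F : PS K) :
    initialForm F = hom F.order.toNat (dehom F.order.toNat F) :=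
  homogeneousComponent_eq _ _

theorem initialForm_hom {d : ℕ} {p : K[X]} (hp : p.natDegree ≤ d) (h0 : p ≠ 0) :
    initialForm (hom d p) = hom d p := by
  have hne : hom d p ≠ 0 := by
    intro h
    have := dehom_hom hp
    rw [h, map_zero] at this
    exact h0 this.symm
  have h1 : initialForm (hom d p) ≠ 0 :=
    MvPowerSeries.homogeneousComponent_of_order
      (ENat.natCast_toNat (mt MvPowerSeries.order_eq_top_iff.1 hne))
  rw [initialForm_eq_hom] at h1 ⊢
  by_cases hd : (hom d p).order.toNat = d
  · rw [hd, dehom_hom hp]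
  · rw [dehom_hom_of_ne p hd, hom_zero] at h1
    exact absurd rfl h1

/-! ### Homogeneous ideals with a prescribed staircase and the homogeneous sub-cell -/

/-- The space of dehomogenised degree `d` parts of the elements of `J`. -/
def dehomSpace (J : Ideal (PS K)) (d : ℕ) : Submodule K K[X] :=
  (J.restrictScalars K).map (dehom d)

theorem mem_dehomSpace {J : Ideal (PS K)} {d : ℕ} {p : K[X]} :
    p ∈ dehomSpace J d ↔ ∃ F ∈ J, dehom d F = p := Iff.rfl

theorem dehom_mem_dehomSpace {J : Ideal (PS K)} {F : PS K} (hF : F ∈ J) (d : ℕ) :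
    dehom d F ∈ dehomSpace J d := ⟨F, hF, rfl⟩

theorem natDegree_le_of_mem_dehomSpace {J : Ideal (PS K)} {d : ℕ} {p : K[X]}
    (hp : p ∈ dehomSpace J d) : p.natDegree ≤ d := by
  obtain ⟨F, -, rfl⟩ := mem_dehomSpace.1 hp
  exact natDegree_dehom_le d F

/-- `J` contains the homogeneous components of its elements. -/
def IsHomog (J : Ideal (PS K)) : Prop := ∀ F ∈ J, ∀ d, hom d (dehom d F) ∈ J

theorem IsHomog.hom_mem {J : Ideal (PS K)} (hJ : IsHomog J) {d : ℕ} {p : K[X]}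
    (hp : p ∈ dehomSpace J d) : hom d p ∈ J := by
  obtain ⟨F, hF, rfl⟩ := mem_dehomSpace.1 hp
  exact hJ F hF d

theorem IsHomog.mul_mem {J : Ideal (PS K)} (hJ : IsHomog J) {i d : ℕ} {q p : K[X]}
    (hq : q.natDegree ≤ i) (hp : p ∈ dehomSpace J d) : q * p ∈ dehomSpace J (i + d) := by
  have hd := natDegree_le_of_mem_dehomSpace hp
  refine mem_dehomSpace.2 ⟨hom (i + d) (q * p), ?_,
    dehom_hom (natDegree_mul_le.trans (add_le_add hq hd))⟩
  rw [hom_mul hq hd]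
  exact Ideal.mul_mem_left _ _ (hJ.hom_mem hp)

theorem IsHomog.X_mul_mem {J : Ideal (PS K)} (hJ : IsHomog J) {d : ℕ} {p : K[X]}
    (hp : p ∈ dehomSpace J d) : X * p ∈ dehomSpace J (d + 1) := by
  rw [add_comm]
  exact hJ.mul_mem natDegree_X_le hp

theorem IsHomog.dehomSpace_mono {J : Ideal (PS K)} (hJ : IsHomog J) : Monotone (dehomSpace J) := by
  intro d d' h p hp
  have := hJ.mul_mem (q := 1) (i := d' - d) (by simp) hp
  rwa [one_mul, Nat.sub_add_cancel h] at this

/-- `J` is homogeneous and its leading exponents are those of the staircase `e`. -/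
structure HasStair (J : Ideal (PS K)) (e : ℕ → ℕ) : Prop where
  isHomog : IsHomog J
  le_of_mem : ∀ d, ∀ p ∈ dehomSpace J d, p ≠ 0 → e p.natDegree ≤ d
  exists_monicAt : ∀ d b, e b ≤ d → ∃ p ∈ dehomSpace J d, MonicAt p b

theorem IsStair.exists_forall_le {e : ℕ → ℕ} {t : ℕ} (he : IsStair e t) :
    ∃ N, ∀ a ≤ N, e a ≤ N := by
  -- Any bound for the finitely many `e a` with `a < t` works; beyond `t` one has `e a = a`.
  refine ⟨∑ a ∈ Finset.range t, e a + t, fun a ha => ?_⟩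
  by_cases hat : a < t
  · exact (Finset.single_le_sum (fun _ _ => Nat.zero_le _) (Finset.mem_range.2 hat)).trans
      (Nat.le_add_right _ _)
  · rwa [he.eq_self a (by omega)]

variable {e : ℕ → ℕ} {t : ℕ} {J : Ideal (PS K)}

/-- In degree `N` every `b ≤ N` is a leading position, so normal forms there vanish and `J` contains
all forms of degree `N`. -/
theorem HasStair.exists_monomial_mem (hJ : HasStair J e) (he : IsStair e t) :
    ∃ N, ∀ x : Fin 2 →₀ ℕ, x.degree = N → MvPowerSeries.monomial x (1 : K) ∈ J := by
  obtain ⟨N, hN⟩ := he.exists_forall_le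
  refine ⟨N, fun x hx => ?_⟩
  rw [monomial_eq_hom, hx]
  refine hJ.isHomog.hom_mem ?_
  obtain ⟨r, h1, h2, h3⟩ := exists_normalForm (S := {b | e b ≤ N}) (hJ.exists_monicAt N) (N + 1)
    (Polynomial.monomial (x 0) (1 : K)) (by
      intro n hn
      rw [degree_eq_add] at hx
      rw [coeff_monomial, if_neg (by omega)])
  have : r = 0 := by
    ext n
    by_cases hn : n ≤ N
    · exact h1 n (hN n hn)
    · exact h2 n (by omega)
  rwa [this, sub_zero] at h3

theorem HasStair.mem_iff (hJ : HasStair J e) (he : IsStair e t) {F : PS K} :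
    F ∈ J ↔ ∀ d, dehom d F ∈ dehomSpace J d := by
  refine ⟨dehom_mem_dehomSpace, fun h => ?_⟩
  obtain ⟨N, hN⟩ := hJ.exists_monomial_mem he
  exact mem_of_hom_dehom_mem hN fun d => hJ.isHomog.hom_mem (h d)

/-- The monomial ideal generated by the monomials with exponent in `S`. -/
def monomialSpan (K : Type u) [Field K] (S : Set (Fin 2 →₀ ℕ)) : Ideal (PS K) :=
  Ideal.span ((fun d => MvPowerSeries.monomial d (1 : K)) '' S)

/-- The exponents above the set `S` are those above the staircase `e`. -/
def Bounds (e : ℕ → ℕ) (S : Set (Fin 2 →₀ ℕ)) : Prop :=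
  ∀ d : Fin 2 →₀ ℕ, (∃ s ∈ S, s ≤ d) ↔ e (d 0) ≤ d.degree

variable {S : Set (Fin 2 →₀ ℕ)}

theorem HasStair.mem_homCell (hτ : Finsupp.single 1 1 ≺[τ] Finsupp.single 0 1)
    (hS : Bounds e S) (he : IsStair e t) (hJ : HasStair J e) :
    J ∈ homCell τ (monomialSpan K S) := by
  refine ⟨le_antisymm (Ideal.span_le.2 ?_) (Ideal.span_le.2 ?_), le_antisymm ?_ ?_⟩
  · rintro _ ⟨F, hF, d, hd, rfl⟩
    have h := hJ.le_of_mem d.degree _ (dehom_mem_dehomSpace hF _)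
      (fun h => hd.coeff_dehom_ne_zero (by rw [h, coeff_zero]))
    rw [hd.natDegree_dehom hτ] at h
    have h1 : MvPowerSeries.monomial d (1 : K) ∈ monomialSpan K S :=
      monomial_mem_span_iff.2 ((hS d).2 h)
    have h2 := Ideal.mul_mem_left _ (MvPowerSeries.monomial 0 (MvPowerSeries.coeff d F)) h1
    rwa [MvPowerSeries.monomial_mul_monomial, zero_add, mul_one] at h2
  · rintro _ ⟨s, hs, rfl⟩
    obtain ⟨p, hp, h1, h2⟩ := hJ.exists_monicAt s.degree (s 0) ((hS s).1 ⟨s, hs, le_rfl⟩)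
    refine Ideal.subset_span ⟨hom s.degree p, hJ.isHomog.hom_mem hp, s,
      isLeadingExp_hom hτ (by rw [h1]; exact one_ne_zero) h2, ?_⟩
    rw [coeff_hom, if_pos rfl, h1]
  -- A nonzero homogeneous element of `J` is its own initial form, so `J*` contains all components
  -- of elements of `J`, and also all monomials of some degree.
  · have key : ∀ (d : ℕ) (p : K[X]), p ∈ dehomSpace J d → hom d p ∈ initialIdeal J := by
      intro d p hp
      by_cases h0 : p = 0
      · rw [h0, hom_zero]
        exact Ideal.zero_mem _
      · exact Ideal.subset_span ⟨hom d p, hJ.isHomog.hom_mem hp,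
          initialForm_hom (natDegree_le_of_mem_dehomSpace hp) h0⟩
    obtain ⟨N, hN⟩ := hJ.exists_monomial_mem he
    intro F hF
    refine mem_of_hom_dehom_mem (N := N) (fun x hx => ?_)
      fun d => key d _ (dehom_mem_dehomSpace hF d)
    have := dehom_mem_dehomSpace (hN x hx) x.degree
    rw [monomial_eq_hom] at this ⊢
    rw [dehom_hom ((natDegree_monomial_le _).trans (by rw [degree_eq_add]; omega))] at this
    exact key _ _ this
  · refine Ideal.span_le.2 ?_
    rintro _ ⟨F, hF, rfl⟩
    rw [initialForm_eq_hom]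
    exact hJ.isHomog F hF _

theorem hasStair_of_mem_homCell (hτ : Finsupp.single 1 1 ≺[τ] Finsupp.single 0 1)
    (hS : Bounds e S) (he : IsStair e t) (hJ : J ∈ homCell τ (monomialSpan K S)) :
    HasStair J e := by
  obtain ⟨hLt, hin⟩ := hJ
  have hH : IsHomog J := by
    intro F hF d
    rw [hin] at hF ⊢
    refine hom_dehom_mem_span ?_ hF d
    rintro _ ⟨G, -, rfl⟩
    rw [initialForm_eq_hom]
    exact ⟨_, fun d hd => dehom_hom_of_ne _ hd⟩
  refine ⟨hH, fun d p hp h0 => ?_, fun d b hb => ?_⟩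
  · have hd := natDegree_le_of_mem_dehomSpace hp
    have hdeg : (expo p.natDegree (d - p.natDegree)).degree = d := by rw [degree_expo]; omega
    have h1 : IsLeadingExp τ (hom d p) (expo p.natDegree (d - p.natDegree)) := by
      have := isLeadingExp_hom (d := expo p.natDegree (d - p.natDegree)) hτ (p := p)
        (by rw [expo_zero]; exact leadingCoeff_ne_zero.2 h0)
        (fun n hn => coeff_eq_zero_of_natDegree_lt (by rwa [expo_zero] at hn))
      rwa [hdeg] at this
    have h2 : MvPowerSeries.monomial (expo p.natDegree (d - p.natDegree))
        (MvPowerSeries.coeff (expo p.natDegree (d - p.natDegree)) (hom d p)) ∈ monomialSpan K S := by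
      rw [← hLt]
      exact Ideal.subset_span ⟨_, hH.hom_mem hp, _, h1, rfl⟩
    have h3 := (hS (expo p.natDegree (d - p.natDegree))).1
      (exists_le_of_mem_span_monomial (S := S)
        (by rintro _ ⟨s, hs, rfl⟩; exact ⟨s, hs, 1, rfl⟩) h2
        (by rw [MvPowerSeries.coeff_monomial_same]; exact h1.1))
    rwa [hdeg, expo_zero] at h3
  · have hbd := (he.le_self b).trans hb
    have hdeg : (expo b (d - b)).degree = d := by rw [degree_expo]; omega
    have h1 : MvPowerSeries.monomial (expo b (d - b)) (1 : K) ∈ leadingTermIdeal τ J := by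
      rw [hLt]
      exact monomial_mem_span_iff.2 ((hS _).2 (by rwa [hdeg, expo_zero]))
    obtain ⟨x, ⟨F, hF, hx⟩, hle⟩ := exists_le_of_mem_span_monomial
      (S := {x | ∃ F ∈ J, IsLeadingExp τ F x})
      (by rintro _ ⟨F, hF, x, hx, rfl⟩; exact ⟨x, ⟨F, hF, hx⟩, _, rfl⟩) h1
      (by rw [MvPowerSeries.coeff_monomial_same]; exact one_ne_zero)
    rw [expo_le_iff, expo_zero, expo_one] at hle
    have hxd := degree_eq_add x
    set p := dehom x.degree F with hp
    -- The leading exponent `x` divides the target monomial: multiply by the missing power of `x`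
    -- and normalise. The missing power of `y` shows only in the degree `d - x.degree` given to the
    -- multiplier.
    refine ⟨Polynomial.monomial (b - x 0) (p.coeff (x 0))⁻¹ * p, ?_, ?_, fun n hn => ?_⟩
    · have := hH.mul_mem (i := d - x.degree) (q := Polynomial.monomial (b - x 0) (p.coeff (x 0))⁻¹)
        ((natDegree_monomial_le _).trans (by omega)) (dehom_mem_dehomSpace hF x.degree)
      rwa [Nat.sub_add_cancel (by omega)] at this
    · have := coeff_monomial_mul p (b - x 0) (x 0) (p.coeff (x 0))⁻¹
      rw [Nat.add_sub_cancel' hle.1] at this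
      rw [this, inv_mul_cancel₀ hx.coeff_dehom_ne_zero]
    · have := coeff_monomial_mul p (b - x 0) (n - (b - x 0)) (p.coeff (x 0))⁻¹
      rw [Nat.sub_add_cancel (by omega)] at this
      rw [this, hp, hx.coeff_dehom_eq_zero hτ (n := n - (b - x 0)) (by omega), mul_zero]

/-! ### The ideal attached to a parameter matrix: existence and uniqueness -/

/-- The ideal of the power series whose degree `d` part lies in `stairSpan e (genSeq c) d`. -/
def stairIdeal (he : IsStair e t) {c : ℕ → ℕ → K} (hc : ∀ a b, ¬ FreePos e a b → c a b = 0) :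
    Ideal (PS K) where
  carrier := {F | ∀ d, dehom d F ∈ stairSpan e (genSeq c) d}
  add_mem' hF hG d := by
    rw [map_add]
    exact Submodule.add_mem _ (hF d) (hG d)
  zero_mem' d := by
    rw [map_zero]
    exact Submodule.zero_mem _
  smul_mem' G F hF d := by
    rw [smul_eq_mul, dehom_mul]
    refine Submodule.sum_mem _ fun p hp => ?_
    rw [← Finset.HasAntidiagonal.mem_antidiagonal.1 hp]
    exact mul_mem_stairSpan he hc (natDegree_dehom_le _ _) (hF p.2)

theorem mem_stairIdeal (he : IsStair e t) {c : ℕ → ℕ → K}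
    (hc : ∀ a b, ¬ FreePos e a b → c a b = 0) {F : PS K} :
    F ∈ stairIdeal he hc ↔ ∀ d, dehom d F ∈ stairSpan e (genSeq c) d := Iff.rfl

theorem le_of_mem_stairSpan {A : Type*} [CommRing A] {c : ℕ → ℕ → A} {d : ℕ} {p : A[X]}
    (hp : p ∈ stairSpan e (genSeq c) d) (h0 : p ≠ 0) : e p.natDegree ≤ d :=
  natDegree_mem_of_mem_span (S := {b | e b ≤ d}) (monicAt_genSeq c) hp h0

theorem hom_mem_stairIdeal (he : IsStair e t) {c : ℕ → ℕ → K}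
    (hc : ∀ a b, ¬ FreePos e a b → c a b = 0) {d : ℕ} {p : K[X]}
    (hp : p ∈ stairSpan e (genSeq c) d) : hom d p ∈ stairIdeal he hc := by
  by_cases h0 : p = 0
  · rw [h0, hom_zero]
    exact Ideal.zero_mem _
  intro d'
  by_cases hd : d' = d
  · rw [hd, dehom_hom ((he.le_self _).trans (le_of_mem_stairSpan hp h0))]
    exact hp
  · rw [dehom_hom_of_ne _ hd]
    exact Submodule.zero_mem _

theorem dehomSpace_stairIdeal (he : IsStair e t) {c : ℕ → ℕ → K}
    (hc : ∀ a b, ¬ FreePos e a b → c a b = 0) (d : ℕ) :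
    dehomSpace (stairIdeal he hc) d = stairSpan e (genSeq c) d := by
  refine le_antisymm ?_ fun p hp => ?_
  · rintro _ ⟨F, hF, rfl⟩
    exact hF d
  · refine mem_dehomSpace.2 ⟨hom d p, hom_mem_stairIdeal he hc hp, ?_⟩
    by_cases h0 : p = 0
    · rw [h0, hom_zero, map_zero]
    · exact dehom_hom ((he.le_self _).trans (le_of_mem_stairSpan hp h0))

theorem hasStair_stairIdeal (he : IsStair e t) {c : ℕ → ℕ → K}
    (hc : ∀ a b, ¬ FreePos e a b → c a b = 0) : HasStair (stairIdeal he hc) e where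
  isHomog _ hF d := hom_mem_stairIdeal he hc (hF d)
  le_of_mem d p hp h0 := by
    rw [dehomSpace_stairIdeal] at hp
    exact le_of_mem_stairSpan hp h0
  exists_monicAt d b hb := by
    rw [dehomSpace_stairIdeal]
    exact ⟨_, mem_stairSpan _ hb, monicAt_genSeq c b⟩

/-- In each degree one space contains the other and both have the same leading positions, so they
agree; `HasStair.mem_iff` then recovers the ideals. -/
theorem HasStair.eq_stairIdeal (hJ : HasStair J e) (he : IsStair e t) {c : ℕ → ℕ → K}
    (hc : ∀ a b, ¬ FreePos e a b → c a b = 0)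
    (h : ∀ a, genSeq c a ∈ dehomSpace J (e a)) : stairIdeal he hc = J := by
  have key : ∀ d, dehomSpace J d = stairSpan e (genSeq c) d := by
    intro d
    have hle : stairSpan e (genSeq c) d ≤ dehomSpace J d := by
      refine Submodule.span_le.2 ?_
      rintro _ ⟨b, hb, rfl⟩
      exact hJ.isHomog.dehomSpace_mono hb (h b)
    exact le_antisymm (le_of_natDegree_mem (S := {b | e b ≤ d})
      (fun b hb => ⟨_, mem_stairSpan _ hb, monicAt_genSeq c b⟩) hle (hJ.le_of_mem d)) hle
  ext F
  rw [hJ.mem_iff he, mem_stairIdeal]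
  simp only [key]

/-- For `g` coming from an actual ideal, the error terms that could leave `J` cancel. The error
splits into `v`, in the required filtration step by induction, and `u`, which must vanish. -/
theorem HasStair.genSeq_mem (hJ : HasStair J e) (he : IsStair e t) {c : ℕ → ℕ → K}
    (hc : ∀ a b, ¬ FreePos e a b → c a b = 0) {g : ℕ → K[X]} (hg : ∀ a, MonicAt (g a) a)
    (hgJ : ∀ a, g a ∈ dehomSpace J (e a)) {h : ℕ → ℕ → K} (hh : ∀ a b, FreePos e a b → h a b = 0)
    (hgh : ∀ a, genSeq c (a + 1) =
      g (a + 1) + ∑ b ∈ Finset.range (a + 1), C (h a b) * genSeq c b) (a : ℕ) :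
    genSeq c a ∈ dehomSpace J (e a) := by
  classical
  induction a using Nat.strong_induction_on with
  | _ a ih =>
    cases a with
    | zero =>
      have : genSeq c 0 = g 0 := by
        rw [genSeq_zero]
        ext n
        rcases Nat.eq_zero_or_pos n with rfl | hn
        · rw [(hg 0).1, coeff_one_zero]
        · rw [(hg 0).2 n hn, coeff_one, if_neg hn.ne']
      rw [this]
      exact hgJ 0
    | succ a =>
      set u := ∑ b ∈ (Finset.range (a + 1)).filter (fun b => ¬ e b ≤ e (a + 1)),
        C (h a b) * genSeq c b with hu
      set v := ∑ b ∈ (Finset.range (a + 1)).filter (fun b => e b ≤ e (a + 1)),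
        C (h a b) * genSeq c b with hv
      have huv : genSeq c (a + 1) = g (a + 1) + (v + u) := by
        rw [hgh a, Finset.sum_filter_add_sum_filter_not]
      have hvJ : v ∈ dehomSpace J (e (a + 1)) := by
        refine Submodule.sum_mem _ fun b hb => ?_
        rw [Finset.mem_filter, Finset.mem_range] at hb
        exact C_mul_mem _ (hJ.isHomog.dehomSpace_mono hb.2 (ih b hb.1))
      -- By the recurrence `f (a + 1)` lies in degree `e a + 1`, and `u` is what remains after
      -- removing `g (a + 1)` and `v`.
      have huJ : u ∈ dehomSpace J (e a + 1) := by
        have h1 : genSeq c (a + 1) ∈ dehomSpace J (e a + 1) := by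
          rw [genSeq_succ]
          refine Submodule.sub_mem _ (hJ.isHomog.X_mul_mem (ih a (Nat.lt_succ_self a)))
            (Submodule.sum_mem _ fun b hb => ?_)
          by_cases hab : FreePos e a b
          · exact C_mul_mem _ (hJ.isHomog.dehomSpace_mono hab.2.2 (ih b (Finset.mem_range.1 hb)))
          · simp [hc a b hab]
        have h2 := hJ.isHomog.dehomSpace_mono (he.succ_le a)
          (Submodule.add_mem _ (hgJ (a + 1)) hvJ)
        have h3 := Submodule.sub_mem _ h1 h2
        rwa [huv, ← add_assoc, add_sub_cancel_left] at h3
      -- Since `h` vanishes at free positions, only `b` with `e b > e a + 1` contribute to `u`; its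
      -- degree would then be a position not allowed in degree `e a + 1`.
      have hu0 : u = 0 := by
        by_contra h0
        have h1 := hJ.le_of_mem _ u huJ h0
        have h2 : u ∈ Submodule.span K (genSeq c '' {b | e a + 1 < e b}) := by
          refine Submodule.sum_mem _ fun b hb => ?_
          rw [Finset.mem_filter, Finset.mem_range] at hb
          by_cases hab : FreePos e a b
          · simp [hh a b hab]
          · refine C_mul_mem _ (Submodule.subset_span ⟨b, ?_, rfl⟩)
            change e a + 1 < e b
            by_contra hlt
            exact hab ⟨by omega, by omega, by omega⟩
        have h3 : e a + 1 < e u.natDegree := natDegree_mem_of_mem_span (monicAt_genSeq c) h2 h0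
        omega
      rw [huv, hu0, add_zero]
      exact Submodule.add_mem _ (hgJ (a + 1)) hvJ

/-- If the matrices agree before row `a`, the difference `u` of the two next polynomials lies in the
step `e (a + 1)` of the common filtration. It is also a combination of `f b` with `e b > e (a + 1)`,
hence zero, and row `a` agrees too. -/
theorem stairIdeal_injective (he : IsStair e t) {c c' : ℕ → ℕ → K}
    (hc : ∀ a b, ¬ FreePos e a b → c a b = 0) (hc' : ∀ a b, ¬ FreePos e a b → c' a b = 0)
    (h : stairIdeal he hc = stairIdeal he hc') : c = c' := by
  have hspan : ∀ d, stairSpan e (genSeq c) d = stairSpan e (genSeq c') d := fun d => by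
    rw [← dehomSpace_stairIdeal he hc, h, dehomSpace_stairIdeal]
  have key : ∀ N, ∀ a < N, c a = c' a := by
    intro N
    induction N with
    | zero => intro a ha; omega
    | succ N ih =>
      intro a ha
      rcases (Nat.lt_succ_iff.1 ha).lt_or_eq with ha | rfl
      · exact ih a ha
      have hseq : ∀ b ≤ a, genSeq c b = genSeq c' b := fun b hb => genSeq_congr ih hb
      set u := ∑ b ∈ Finset.range (a + 1), C (c a b - c' a b) * genSeq c b with hu
      have h1 : u = genSeq c' (a + 1) - genSeq c (a + 1) := by
        rw [genSeq_succ, genSeq_succ, ← hseq a le_rfl, sub_sub_sub_cancel_left,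
          ← Finset.sum_sub_distrib]
        refine Finset.sum_congr rfl fun b hb => ?_
        rw [Finset.mem_range] at hb
        rw [← hseq b (by omega), C_sub, sub_mul]
      have h2 : u ∈ stairSpan e (genSeq c) (e (a + 1)) := by
        rw [h1]
        refine Submodule.sub_mem _ ?_ (mem_stairSpan _ le_rfl)
        rw [hspan]
        exact mem_stairSpan _ le_rfl
      have h3 : u ∈ Submodule.span K (genSeq c '' {b | e (a + 1) < e b}) := by
        refine Submodule.sum_mem _ fun b _ => ?_
        by_cases hab : FreePos e a b
        · exact C_mul_mem _ (Submodule.subset_span ⟨b, hab.2.1, rfl⟩)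
        · simp [hc a b hab, hc' a b hab]
      have h4 : u = 0 := by
        by_contra h0
        have h5 := le_of_mem_stairSpan h2 h0
        have h6 : e (a + 1) < e u.natDegree := natDegree_mem_of_mem_span (monicAt_genSeq c) h3 h0
        omega
      funext b
      by_cases hb : b ≤ a
      · exact sub_eq_zero.1 (eq_zero_of_sum_eq_zero (γ := fun b => c a b - c' a b)
          (monicAt_genSeq c) h4 (Nat.lt_succ_of_le hb))
      · have hab : ¬ FreePos e a b := fun h => hb h.1
        rw [hc a b hab, hc' a b hab]
  funext a
  exact key (a + 1) a (Nat.lt_succ_self a)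

end

/-! ### Zero-dimensionality gives powers of the variables -/

/-- A nonzero quotient is local of dimension zero, so its nonunits are nilpotent; the unit ideal is
treated separately. -/
theorem exists_pow_mem_of_krullDimLE {k : Type u} [Field k] {E : Ideal (PS k)}
    (hE : Ring.KrullDimLE 0 (PS k ⧸ E)) {f : PS k} (hf : MvPowerSeries.constantCoeff f = 0) :
    ∃ N, f ^ N ∈ E := by
  by_cases htop : E = ⊤
  · exact ⟨0, htop ▸ Submodule.mem_top⟩
  have : Nontrivial (PS k ⧸ E) := Ideal.Quotient.nontrivial_iff.2 htop
  have : IsLocalRing (PS k ⧸ E) :=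
    IsLocalRing.of_surjective' (Ideal.Quotient.mk E) Ideal.Quotient.mk_surjective
  have hnu : Ideal.Quotient.mk E f ∈ nonunits (PS k ⧸ E) := by
    intro hu
    obtain ⟨g, hg⟩ := hu.exists_right_inv
    obtain ⟨g, rfl⟩ := Ideal.Quotient.mk_surjective g
    rw [← map_mul, ← map_one (Ideal.Quotient.mk E), Ideal.Quotient.eq] at hg
    refine htop (Ideal.eq_top_of_isUnit_mem _ hg (MvPowerSeries.isUnit_iff_constantCoeff.2 ?_))
    simp [hf]
  obtain ⟨N, hN⟩ := Ring.KrullDimLE.isNilpotent_iff_mem_nonunits.2 hnu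
  rw [← map_pow, Ideal.Quotient.eq_zero_iff_mem] at hN
  exact ⟨N, hN⟩

theorem exists_monomial_mem_of_krullDimLE {k : Type u} [Field k] {E : Ideal (PS k)}
    (hE : Ring.KrullDimLE 0 (PS k ⧸ E)) (i : Fin 2) :
    ∃ N, MvPowerSeries.monomial (Finsupp.single i N) (1 : k) ∈ E := by
  obtain ⟨N, hN⟩ := exists_pow_mem_of_krullDimLE hE (MvPowerSeries.constantCoeff_X i)
  rw [MvPowerSeries.X_pow_eq] at hN
  exact ⟨N, hN⟩

/-! ### The staircase of a monomial ideal and the count of free positions -/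

section Staircase

variable (S : Set (Fin 2 →₀ ℕ))

/-- The least power of `y` whose product with `x ^ a` lies above `S`. -/
def yMin (a : ℕ) : ℕ := sInf {b | ∃ s ∈ S, s ≤ expo a b}

/-- The least power of `x` above `S`. -/
def xMin : ℕ := sInf {a | ∃ s ∈ S, s ≤ expo a 0}

variable {S} {M N : ℕ}

theorem yMin_le_iff (hy : ∃ s ∈ S, s ≤ expo 0 N) {a b : ℕ} :
    yMin S a ≤ b ↔ ∃ s ∈ S, s ≤ expo a b := by
  refine ⟨fun h => ?_, fun h => Nat.sInf_le h⟩
  have hne : {b | ∃ s ∈ S, s ≤ expo a b}.Nonempty := by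
    obtain ⟨s, hs, hle⟩ := hy
    rw [expo_le_iff, expo_zero, expo_one] at hle
    exact ⟨N, s, hs, by rw [expo_le_iff, expo_zero, expo_one]; omega⟩
  obtain ⟨s, hs, hle⟩ := Nat.sInf_mem hne
  rw [expo_le_iff, expo_zero, expo_one] at hle
  refine ⟨s, hs, ?_⟩
  rw [expo_le_iff, expo_zero, expo_one]
  exact ⟨hle.1, hle.2.trans h⟩

theorem isStair_yMin (hx : ∃ s ∈ S, s ≤ expo M 0) (hy : ∃ s ∈ S, s ≤ expo 0 N) :
    IsStair (fun a => a + yMin S a) (xMin S) where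
  le_self a := Nat.le_add_right _ _
  succ_le a := by
    have : yMin S (a + 1) ≤ yMin S a := by
      rw [yMin_le_iff hy]
      obtain ⟨s, hs, hle⟩ := (yMin_le_iff hy).1 (le_refl (yMin S a))
      rw [expo_le_iff, expo_zero, expo_one] at hle
      exact ⟨s, hs, by rw [expo_le_iff, expo_zero, expo_one]; omega⟩
    omega
  eq_self a ha := by
    have : yMin S a ≤ 0 := by
      rw [yMin_le_iff hy]
      obtain ⟨s, hs, hle⟩ : ∃ s ∈ S, s ≤ expo (xMin S) 0 :=
        Nat.sInf_mem (s := {a | ∃ s ∈ S, s ≤ expo a 0}) ⟨M, hx⟩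
      rw [expo_le_iff, expo_zero, expo_one] at hle
      exact ⟨s, hs, by rw [expo_le_iff, expo_zero, expo_one]; omega⟩
    omega

theorem bounds_yMin (hy : ∃ s ∈ S, s ≤ expo 0 N) : Bounds (fun a => a + yMin S a) S := by
  intro d
  rw [degree_eq_add, add_le_add_iff_left, yMin_le_iff hy, expo_self]

variable (k : Type u) [Field k]

theorem xExp_monomialSpan : xExp (monomialSpan k S) = xMin S := by
  simp only [xExp, xMin, monomialSpan, monomial_mem_span_iff]

theorem yExp_monomialSpan (i : ℕ) : yExp (monomialSpan k S) i = yMin S (xMin S - i) := by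
  simp only [yExp, yMin, xExp_monomialSpan]
  simp only [monomialSpan, monomial_mem_span_iff]

open Classical in
/-- The finite set of the positions of the free parameters. -/
def freePositions (e : ℕ → ℕ) (t : ℕ) : Finset (ℕ × ℕ) :=
  (Finset.range t ×ˢ Finset.range (t + 1)).filter fun p => FreePos e p.1 p.2

theorem mem_freePositions {e : ℕ → ℕ} {t : ℕ} (he : IsStair e t) {a b : ℕ} :
    (a, b) ∈ freePositions e t ↔ FreePos e a b := by
  simp only [freePositions, Finset.mem_filter, Finset.mem_product, Finset.mem_range]
  refine ⟨fun h => h.2, fun h => ⟨?_, h⟩⟩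
  have h1 := he.lt_of_freePos h
  have h2 := h.1
  omega

/-- Put `a = t - j` and `b = t + 1 - i`. Then `u_{i,j} = e a + 1 - e b` and `d_j = e a + 1 - e (a +
1)`, so `i > j` and `0 ≤ u_{i,j} < d_j` become the conditions of `FreePos`. -/
theorem card_homPositions (hx : ∃ s ∈ S, s ≤ expo M 0) (hy : ∃ s ∈ S, s ≤ expo 0 N) :
    (homPositions (monomialSpan k S)).card =
      (freePositions (fun a => a + yMin S a) (xMin S)).card := by
  have he := isStair_yMin hx hy
  have hmem : ∀ i j, (i, j) ∈ homPositions (monomialSpan k S) ↔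
      (1 ≤ i ∧ i ≤ xMin S + 1) ∧ (1 ≤ j ∧ j ≤ xMin S) ∧
        FreePos (fun a => a + yMin S a) (xMin S - j) (xMin S + 1 - i) := by
    intro i j
    simp only [homPositions, degEntry, stepDeg, yExp_monomialSpan, xExp_monomialSpan,
      Finset.mem_filter, Finset.mem_product, Finset.mem_Icc, FreePos, and_assoc]
    refine and_congr_right fun h1 => and_congr_right fun h2 => and_congr_right fun h3 =>
      and_congr_right fun h4 => ?_
    rw [show xMin S - j + 1 = xMin S - (j - 1) by omega,
      show xMin S - (i - 1) = xMin S + 1 - i by omega]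
    omega
  refine Finset.card_bij' (fun p _ => (xMin S - p.2, xMin S + 1 - p.1))
    (fun p _ => (xMin S + 1 - p.2, xMin S - p.1)) ?_ ?_ ?_ ?_
  · rintro ⟨i, j⟩ h
    rw [hmem] at h
    exact (mem_freePositions he).2 h.2.2
  · rintro ⟨a, b⟩ h
    rw [mem_freePositions he] at h
    have h1 := he.lt_of_freePos h
    have h2 := h.1
    dsimp only
    rw [hmem, show xMin S - (xMin S - a) = a by omega,
      show xMin S + 1 - (xMin S + 1 - b) = b by omega]
    exact ⟨by omega, by omega, h⟩
  · rintro ⟨i, j⟩ h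
    rw [hmem] at h
    ext <;> dsimp only <;> omega
  · rintro ⟨a, b⟩ h
    rw [mem_freePositions he] at h
    have h1 := he.lt_of_freePos h
    have h2 := h.1
    ext <;> dsimp only <;> omega

end Staircase

/-! ### Parameter matrices and change of rings -/

section Parameters

variable {e : ℕ → ℕ} {t : ℕ}

/-- The matrix with the given entries at the free positions, and `0` elsewhere. -/
def paramMatrix (e : ℕ → ℕ) (t : ℕ) {A : Type*} [Zero A]
    (v : Fin (freePositions e t).card → A) (a b : ℕ) : A :=
  if h : (a, b) ∈ freePositions e t then v ((freePositions e t).equivFin ⟨(a, b), h⟩) else 0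

theorem paramMatrix_eq_zero (he : IsStair e t) {A : Type*} [Zero A]
    (v : Fin (freePositions e t).card → A) (a b : ℕ) (h : ¬ FreePos e a b) :
    paramMatrix e t v a b = 0 :=
  dif_neg (mt (mem_freePositions he).1 h)

theorem paramMatrix_map {A B : Type*} [CommRing A] [CommRing B] (φ : A →+* B)
    (v : Fin (freePositions e t).card → A) :
    (fun a b => φ (paramMatrix e t v a b)) = paramMatrix e t fun s => φ (v s) := by
  funext a b
  rw [paramMatrix, paramMatrix]
  split_ifs
  · rfl
  · exact map_zero φ

theorem paramMatrix_injective {A : Type*} [Zero A] :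
    Function.Injective (paramMatrix e t (A := A)) := by
  intro v w h
  funext s
  have hs := congrFun (congrFun h ((freePositions e t).equivFin.symm s).1.1)
    ((freePositions e t).equivFin.symm s).1.2
  have hmem := ((freePositions e t).equivFin.symm s).2
  rw [paramMatrix, paramMatrix, dif_pos hmem, dif_pos hmem] at hs
  simpa using hs

theorem paramMatrix_entries (he : IsStair e t) {A : Type*} [Zero A] {c : ℕ → ℕ → A}
    (hc : ∀ a b, ¬ FreePos e a b → c a b = 0) :
    paramMatrix e t (fun s => c ((freePositions e t).equivFin.symm s).1.1
      ((freePositions e t).equivFin.symm s).1.2) = c := by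
  funext a b
  rw [paramMatrix]
  split_ifs with h
  · simp
  · exact (hc a b (mt (mem_freePositions he).2 h)).symm

theorem map_mem_stairSpan {A B : Type*} [CommRing A] [CommRing B] (φ : A →+* B)
    {c : ℕ → ℕ → A} {d : ℕ} {p : A[X]} (hp : p ∈ stairSpan e (genSeq c) d) :
    p.map φ ∈ stairSpan e (genSeq fun a b => φ (c a b)) d := by
  induction hp using Submodule.span_induction with
  | mem p hp =>
    obtain ⟨b, hb, rfl⟩ := hp
    rw [genSeq_map]
    exact mem_stairSpan _ hb
  | zero => rw [Polynomial.map_zero]; exact Submodule.zero_mem _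
  | add p q _ _ hp hq => rw [Polynomial.map_add]; exact Submodule.add_mem _ hp hq
  | smul r p _ hp =>
    rw [smul_eq_C_mul, Polynomial.map_mul, map_C]
    exact C_mul_mem _ hp

end Parameters

/-! ### Chart coordinates as normal forms -/

section ChartCoordinates

variable {K : Type u} [Field K] {e : ℕ → ℕ} {t : ℕ} {S : Set (Fin 2 →₀ ℕ)} {J : Ideal (PS K)}

theorem Bounds.monomial_mem_iff (hS : Bounds e S) {d : Fin 2 →₀ ℕ} :
    MvPowerSeries.monomial d (1 : K) ∈ monomialSpan K S ↔ e (d 0) ≤ d.degree :=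
  monomial_mem_span_iff.trans (hS d)

theorem HasStair.isChartCoord (hJ : HasStair J e) (hS : Bounds e S)
    {r : (Fin 2 →₀ ℕ) → K[X]} (h0 : ∀ m b, e b ≤ m.degree → (r m).coeff b = 0)
    (hr : ∀ m, Polynomial.monomial (m 0) 1 - r m ∈ dehomSpace J m.degree) :
    IsChartCoord (monomialSpan K S) J
      fun m b => MvPowerSeries.coeff b (hom m.degree (r m)) := by
  refine fun m => ⟨fun b hb => ?_, ?_⟩
  · rw [hS.monomial_mem_iff] at hb
    change MvPowerSeries.coeff b (hom m.degree (r m)) = 0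
    rw [coeff_hom]
    split_ifs with h
    · exact h0 m _ (h ▸ hb)
    · rfl
  · have := hJ.isHomog.hom_mem (hr m)
    rw [hom_sub, ← monomial_eq_hom] at this
    exact this

theorem HasStair.exists_isChartCoord (hJ : HasStair J e) (hS : Bounds e S) :
    ∃ a, IsChartCoord (monomialSpan K S) J a := by
  have : ∀ m : Fin 2 →₀ ℕ, ∃ r : K[X], (∀ b, e b ≤ m.degree → r.coeff b = 0) ∧
      Polynomial.monomial (m 0) 1 - r ∈ dehomSpace J m.degree := by
    intro m
    obtain ⟨r, h1, -, h2⟩ := exists_normalForm (S := {b | e b ≤ m.degree})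
      (hJ.exists_monicAt m.degree) (m 0 + 1) (Polynomial.monomial (m 0) (1 : K))
      fun n hn => by rw [coeff_monomial, if_neg (by omega)]
    exact ⟨r, h1, h2⟩
  choose r h1 h2 using this
  exact ⟨_, hJ.isChartCoord hS h1 h2⟩

/-- The difference of two normal forms lies in `J`; a nonzero component would have its leading
monomial in `E`, where both coefficients vanish. -/
theorem HasStair.isChartCoord_unique (hJ : HasStair J e) (hS : Bounds e S)
    {a a' : (Fin 2 →₀ ℕ) → (Fin 2 →₀ ℕ) → K} (ha : IsChartCoord (monomialSpan K S) J a)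
    (ha' : IsChartCoord (monomialSpan K S) J a') : a = a' := by
  funext m
  obtain ⟨h1, h2⟩ := ha m
  obtain ⟨h1', h2'⟩ := ha' m
  have hD : (show PS K from a m - a' m) ∈ J := by
    have := J.sub_mem h2' h2
    rwa [sub_sub_sub_cancel_left] at this
  refine sub_eq_zero.1 (ext_dehom (F := show PS K from a m - a' m) (G := 0) fun d => ?_)
  rw [map_zero]
  by_contra h0
  have hmem := dehom_mem_dehomSpace hD d
  have hle := hJ.le_of_mem d _ hmem h0
  have hd := natDegree_dehom_le d (show PS K from a m - a' m)
  set n := (dehom d (show PS K from a m - a' m)).natDegree with hn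
  refine leadingCoeff_ne_zero.2 h0 ?_
  rw [leadingCoeff, ← hn, coeff_dehom, if_pos hd]
  have hx : MvPowerSeries.monomial (expo n (d - n)) (1 : K) ∈ monomialSpan K S := by
    rw [hS.monomial_mem_iff, degree_expo, expo_zero]
    omega
  change a m (expo n (d - n)) - a' m (expo n (d - n)) = 0
  rw [h1 _ hx, h1' _ hx, sub_zero]

/-- The reduced polynomial with leading term `X ^ n` whose lower coefficients are read off from
chart coordinates `a`. -/
def reducedPoly {A : Type*} [CommRing A] (e : ℕ → ℕ)
    (a : (Fin 2 →₀ ℕ) → (Fin 2 →₀ ℕ) → A) (n : ℕ) : A[X] :=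
  Polynomial.monomial n 1 -
    ∑ b ∈ Finset.range n, Polynomial.monomial b (a (expo n (e n - n)) (expo b (e n - b)))

theorem coeff_reducedPoly {A : Type*} [CommRing A]
    (a : (Fin 2 →₀ ℕ) → (Fin 2 →₀ ℕ) → A) (n i : ℕ) :
    (reducedPoly e a n).coeff i = (if n = i then 1 else 0) -
      if i < n then a (expo n (e n - n)) (expo i (e n - i)) else 0 := by
  rw [reducedPoly, coeff_sub, coeff_monomial, finsetSum_coeff]
  simp only [coeff_monomial, Finset.sum_ite_eq', Finset.mem_range]

theorem monicAt_reducedPoly {A : Type*} [CommRing A]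
    (a : (Fin 2 →₀ ℕ) → (Fin 2 →₀ ℕ) → A) (n : ℕ) : MonicAt (reducedPoly e a n) n := by
  refine ⟨by simp [coeff_reducedPoly], fun i hi => ?_⟩
  rw [coeff_reducedPoly, if_neg (by omega), if_neg (by omega), sub_zero]

theorem reducedPoly_map {A B : Type*} [CommRing A] [CommRing B] (φ : A →+* B)
    (a : (Fin 2 →₀ ℕ) → (Fin 2 →₀ ℕ) → A) (n : ℕ) :
    (reducedPoly e a n).map φ = reducedPoly e (fun m b => φ (a m b)) n := by
  simp [reducedPoly, Polynomial.map_sum]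

/-- The degree `e n` part `R` of the normal form of `x^n y^(e n - n)` has degree below `n` or is
zero, so `reducedPoly`, which keeps only lower coefficients, loses nothing. -/
theorem HasStair.reducedPoly_mem (hJ : HasStair J e) (hS : Bounds e S) (he : IsStair e t)
    {a : (Fin 2 →₀ ℕ) → (Fin 2 →₀ ℕ) → K} (ha : IsChartCoord (monomialSpan K S) J a) (n : ℕ) :
    reducedPoly e a n ∈ dehomSpace J (e n) := by
  obtain ⟨h1, h2⟩ := ha (expo n (e n - n))
  have hn := he.le_self n
  have hdeg : (expo n (e n - n)).degree = e n := by rw [degree_expo]; omega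
  have hmem := dehom_mem_dehomSpace h2 (e n)
  set R := dehom (e n) (show PS K from fun b => a (expo n (e n - n)) b) with hR
  have hRc : ∀ i, R.coeff i = if i ≤ e n then a (expo n (e n - n)) (expo i (e n - i)) else 0 :=
    fun i => by rw [hR, coeff_dehom]; rfl
  have hmon : dehom (e n) (MvPowerSeries.monomial (expo n (e n - n)) (1 : K)) =
      Polynomial.monomial n 1 := by
    rw [monomial_eq_hom, hdeg, expo_zero, dehom_hom ((natDegree_monomial_le _).trans hn)]
  rw [map_sub, hmon, ← hR] at hmem
  have hoff : ∀ i, e i ≤ e n → R.coeff i = 0 := by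
    intro i hi
    have := he.le_self i
    rw [hRc, if_pos (by omega)]
    refine h1 _ (hS.monomial_mem_iff.2 ?_)
    rw [degree_expo, expo_zero]
    omega
  -- Otherwise `X ^ n - R` would have the degree of `R`, a leading position in degree `e n`, where
  -- `R` has coefficient zero.
  have hdegR : R.natDegree ≤ n := by
    by_contra hlt
    have hR0 : R ≠ 0 := by
      rintro h0
      rw [h0, natDegree_zero] at hlt
      omega
    have hnd : (Polynomial.monomial n 1 - R).natDegree = R.natDegree :=
      natDegree_sub_eq_right_of_natDegree_lt
        ((natDegree_monomial_le _).trans_lt (not_le.1 hlt))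
    have h0 : Polynomial.monomial n 1 - R ≠ 0 := by
      rintro h0
      rw [h0, natDegree_zero] at hnd
      omega
    have := hJ.le_of_mem _ _ hmem h0
    rw [hnd] at this
    exact leadingCoeff_ne_zero.2 hR0 (hoff _ this)
  convert hmem using 1
  ext i
  rw [coeff_reducedPoly, coeff_sub, coeff_monomial]
  congr 1
  split_ifs with hi
  · rw [hRc, if_pos (by omega)]
  · rcases (not_lt.1 hi).eq_or_lt with rfl | hi
    · rw [hoff _ le_rfl]
    · rw [coeff_eq_zero_of_natDegree_lt (by omega)]

end ChartCoordinates

/-! ### The parametrisation by polynomials and the main theorem -/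

theorem extend_monomialSpan {k : Type u} [Field k] (K : Type u) [Field K] [Algebra k K]
    (S : Set (Fin 2 →₀ ℕ)) : extend K (monomialSpan k S) = monomialSpan K S := by
  rw [extend, monomialSpan, Ideal.map_span, Set.image_image]
  simp [monomialSpan]

theorem isAffineSpaceOfDim_homCell {k : Type u} [Field k] {τ : MonomialOrder (Fin 2)}
    (hτ : Finsupp.single 1 1 ≺[τ] Finsupp.single 0 1) {S : Set (Fin 2 →₀ ℕ)} {e : ℕ → ℕ} {t : ℕ}
    (he : IsStair e t) (hS : Bounds e S) :
    IsAffineSpaceOfDim (monomialSpan k S)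
      (fun K [Field K] [Algebra k K] => homCell τ (extend K (monomialSpan k S)))
      (freePositions e t).card := by
  refine ⟨fun K _ _ J hJ => ?_, ?_⟩
  · change J ∈ homCell τ (extend K (monomialSpan k S)) at hJ
    rw [extend_monomialSpan] at hJ ⊢
    have hJ' := hasStair_of_mem_homCell hτ hS he hJ
    obtain ⟨a, ha⟩ := hJ'.exists_isChartCoord hS
    exact ⟨a, ha, fun a' ha' => hJ'.isChartCoord_unique hS ha' ha⟩
  -- Normal forms for the generic matrix: their coefficients are the polynomials `P`, defined over
  -- `k` before any `K` is chosen.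
  have hnf : ∀ m : Fin 2 →₀ ℕ, ∃ r : (MvPolynomial (Fin (freePositions e t).card) k)[X],
      (∀ b, e b ≤ m.degree → r.coeff b = 0) ∧ Polynomial.monomial (m 0) 1 - r ∈
        stairSpan e (genSeq (paramMatrix e t MvPolynomial.X)) m.degree := by
    intro m
    obtain ⟨r, h1, -, h2⟩ := exists_normalForm (S := {b | e b ≤ m.degree})
      (fun b hb => ⟨_, mem_stairSpan _ hb,
        monicAt_genSeq (paramMatrix e t (MvPolynomial.X (R := k))) b⟩)
      (m 0 + 1) (Polynomial.monomial (m 0) 1)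
      fun n hn => by rw [coeff_monomial, if_neg (by omega)]
    exact ⟨r, h1, h2⟩
  choose r hr0 hr using hnf
  -- With an independent variable for each chart coordinate, the entries of `c` are the polynomials
  -- `Q`.
  obtain ⟨c, hc, h, hh, hch⟩ := exists_genSeq_eq_add_sum
    (monicAt_reducedPoly (e := e) fun m b =>
      (MvPolynomial.X (m, b) : MvPolynomial ((Fin 2 →₀ ℕ) × (Fin 2 →₀ ℕ)) k))
    (FreePos e) t fun a b hab => he.lt_of_freePos hab
  refine ⟨fun m b => MvPowerSeries.coeff b (hom m.degree (r m)),
    fun s => c ((freePositions e t).equivFin.symm s).1.1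
      ((freePositions e t).equivFin.symm s).1.2, fun K _ _ => ?_⟩
  dsimp only
  have hext := extend_monomialSpan (k := k) K S
  have hcell : ∀ J, J ∈ homCell τ (extend K (monomialSpan k S)) ↔ HasStair J e := fun J => by
    rw [hext]
    exact ⟨hasStair_of_mem_homCell hτ hS he, HasStair.mem_homCell hτ hS he⟩
  have hchart : ∀ J a, IsChartCoord (extend K (monomialSpan k S)) J a ↔
      IsChartCoord (monomialSpan K S) J a := fun J a => by rw [hext]
  -- Evaluating `Q` at the coordinates of `J` gives parameters whose ideal is `J`: this yields both
  -- surjectivity and the formula for the inverse.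
  have hrec : ∀ J, HasStair J e → ∀ a, IsChartCoord (monomialSpan K S) J a →
      stairIdeal he (paramMatrix_eq_zero he fun s => MvPolynomial.aeval (fun p => a p.1 p.2)
        (c ((freePositions e t).equivFin.symm s).1.1
          ((freePositions e t).equivFin.symm s).1.2)) = J := by
    intro J hJ' a ha
    set φ : MvPolynomial ((Fin 2 →₀ ℕ) × (Fin 2 →₀ ℕ)) k →+* K :=
      (MvPolynomial.aeval fun p : (Fin 2 →₀ ℕ) × (Fin 2 →₀ ℕ) => a p.1 p.2).toRingHom with hφ
    have hφX : ∀ m b, φ (MvPolynomial.X (m, b)) = a m b := fun m b => by simp [hφ]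
    have hcφ : ∀ i j, ¬ FreePos e i j → φ (c i j) = 0 := fun i j hij => by
      rw [hc i j hij, map_zero]
    refine hJ'.eq_stairIdeal he _ ?_
    have hpm := paramMatrix_entries he hcφ
    change ∀ i, genSeq (paramMatrix e t fun s => φ (c ((freePositions e t).equivFin.symm s).1.1
      ((freePositions e t).equivFin.symm s).1.2)) i ∈ dehomSpace J (e i)
    rw [hpm]
    refine hJ'.genSeq_mem he hcφ (monicAt_reducedPoly a) (hJ'.reducedPoly_mem hS he ha)
      (h := fun i j => φ (h i j)) (fun i j hij => by rw [hh i j hij, map_zero]) fun i => ?_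
    have := congrArg (Polynomial.map φ) (hch i)
    rw [Polynomial.map_add, Polynomial.map_sum, reducedPoly_map, genSeq_map] at this
    simp only [hφX, Polynomial.map_mul, map_C, genSeq_map] at this
    exact this
  let Φ : (Fin (freePositions e t).card → K) → homCell τ (extend K (monomialSpan k S)) :=
    fun v => ⟨stairIdeal he (paramMatrix_eq_zero he v), (hcell _).2 (hasStair_stairIdeal he _)⟩
  have hΦ : Function.Bijective Φ := by
    refine ⟨fun v w hvw => paramMatrix_injective
      (stairIdeal_injective he (paramMatrix_eq_zero he v) (paramMatrix_eq_zero he w) (congrArg Subtype.val hvw)), fun J => ?_⟩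
    obtain ⟨a, ha⟩ := ((hcell J).1 J.2).exists_isChartCoord hS
    exact ⟨_, Subtype.ext (hrec J ((hcell J).1 J.2) a ha)⟩
  refine ⟨Equiv.ofBijective Φ hΦ, fun v => ?_, fun J a ha s => ?_⟩
  · set φ : MvPolynomial (Fin (freePositions e t).card) k →+* K :=
      (MvPolynomial.aeval v).toRingHom with hφ
    have hcoord := (hasStair_stairIdeal he (paramMatrix_eq_zero he v)).isChartCoord hS
      (r := fun m => (r m).map φ)
      (fun m b hb => by rw [Polynomial.coeff_map, hr0 m b hb, map_zero]) (fun m => by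
        have := map_mem_stairSpan φ (hr m)
        rw [paramMatrix_map] at this
        rw [dehomSpace_stairIdeal]
        simpa [hφ] using this)
    refine (hchart _ _).2 ?_
    change IsChartCoord _ (stairIdeal he (paramMatrix_eq_zero he v)) _
    convert hcoord using 3 with m b
    rw [coeff_hom, coeff_hom, Polynomial.coeff_map]
    split_ifs
    · rfl
    · exact map_zero φ
  · have h1 : Φ (fun s => MvPolynomial.aeval (fun p => a p.1 p.2)
        (c ((freePositions e t).equivFin.symm s).1.1
          ((freePositions e t).equivFin.symm s).1.2)) = J :=
      Subtype.ext (hrec J ((hcell J).1 J.2) a ((hchart _ _).1 ha))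
    have h2 := (Equiv.ofBijective Φ hΦ).symm_apply_apply (fun s =>
      MvPolynomial.aeval (fun p => a p.1 p.2) (c ((freePositions e t).equivFin.symm s).1.1
        ((freePositions e t).equivFin.symm s).1.2))
    rw [Equiv.ofBijective_apply, h1] at h2
    exact congrFun h2 s

end LocalCell
end

theorem mainTheorem3 {k : Type*} [Field k] (τ : MonomialOrder (Fin 2))
    (hτ : Finsupp.single 1 1 ≺[τ] Finsupp.single 0 1)
    (E : Ideal (LocalCell.PS k)) (hE : LocalCell.IsMonomialIdeal E)
    (hE0 : Ring.KrullDimLE 0 (LocalCell.PS k ⧸ E)) :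
    LocalCell.IsAffineSpaceOfDim E
      (fun K [Field K] [Algebra k K] => LocalCell.homCell τ (LocalCell.extend K E))
      (LocalCell.homPositions E).card := by
  obtain ⟨S, rfl⟩ := hE
  obtain ⟨M, hM⟩ := LocalCell.exists_monomial_mem_of_krullDimLE hE0 0
  obtain ⟨N, hN⟩ := LocalCell.exists_monomial_mem_of_krullDimLE hE0 1
  have hx : ∃ s ∈ S, s ≤ LocalCell.expo M 0 := by
    simpa [LocalCell.expo] using LocalCell.monomial_mem_span_iff.1 hM
  have hy : ∃ s ∈ S, s ≤ LocalCell.expo 0 N := by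
    simpa [LocalCell.expo] using LocalCell.monomial_mem_span_iff.1 hN
  have hcard := LocalCell.card_homPositions k hx hy
  rw [LocalCell.monomialSpan] at hcard
  rw [hcard]
  exact LocalCell.isAffineSpaceOfDim_homCell hτ (LocalCell.isStair_yMin hx hy)
    (LocalCell.bounds_yMin hy)
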